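/- Consider two qubits with basis $|-\rangle,|+\rangle$, the $i$-th one ($i=1,2$) coupled to its own bath $B_i$ of $N$ spins-$\tfrac12$. With $\alpha,\delta\in\mathbb R$, $\alpha\neq0$, let $$H_N=4\delta S^1_zS^2_z+\frac{\alpha}{\sqrt N}\sum_{i=1}^{2}\Bigl(S^i_+\sum_{k=1}^N S^{ik}_-+S^i_-\sum_{k=1}^N S^{ik}_+\Bigr)$$ and let $$\rho_N(t)=\mathrm{tr}_{B_1+B_2}\Bigl[e^{-iH_Nt}\Bigl(\rho(0)\otimes\frac{\mathbf 1}{2^N}\otimes\frac{\mathbf 1}{2^N}\Bigr)e^{iH_Nt}\Bigr]$$ be the reduced density matrix of the qubits for the singlet initial state $\rho(0)=|\psi\rangle\langle\psi|$, $\psi=\frac1{\sqrt2}(|-+\rangle-|+-\rangle)$. Let $C(\rho)=\max\{0,2\max_i\sqrt{\lambda_i}-\sum_{i=1}^4\sqrt{\lambda_i}\}$ be the concurrence, where the $\lambda_i$ are the eigenvalues of $\rho(\sigma_y\otimes\sigma_y)\rho^*(\sigma_y\otimes\sigma_y)$. Let $f(r)=4re^{-2r^2}$ for $r\ge0$, $$\Lambda_\pm(t)=\int_0^\infty\!\!\int_0^\infty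 f(r)f(s)\,\frac{\alpha^2(r\pm s)^2}{\delta^2+\alpha^2(r\pm s)^2}\,\sin^2\!\Bigl(t\sqrt{\delta^2+\alpha^2(r\pm s)^2}\Bigr)\,dr\,ds ,$$ let $Q(\mu)=\int_0^\mu f(\mu-r)f(r)\,dr$ $(\mu\ge0)$ and $R(\eta)=\int_{\max(0,-\eta)}^\infty f(\eta+s)f(s)\,ds$ $(\eta\in\mathbb R)$ be the densities of $r+s$ and $r-s$ for independent $r,s$ with density $f$, and put $$\Lambda_+(\infty)=\frac12\int_0^\infty Q(\mu)\frac{\alpha^2\mu^2}{\delta^2+\alpha^2\mu^2}\,d\mu,\quad \Lambda_-(\infty)=\frac12\int_{-\infty}^\infty R(\eta)\frac{\alpha^2\eta^2}{\delta^2+\alpha^2\eta^2}\,d\eta,\quad \Pi=\Lambda_+(\infty)+\Lambda_-(\infty).$$ Then, for every $\alpha\ne0$ and every $\delta\in\mathbb R$: 1. $\Lambda_\pm(t)\to\Lambda_\pm(\infty)$ as $t\to\infty$, and $0\le\Pi\le1$. 2. For every $t\in\mathbb R$ the limit $\rho(t)=\lim_{N\to\infty}\rho_N(t)$ exists, and as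 $t\to\infty$, $\rho(t)$ converges to $$\rho(\infty)=\begin{pmatrix}\frac{\Pi}{4}&0&0&0\\0&\frac{2-\Pi}{4}&-\frac{2-\Pi}{8}&0\\0&-\frac{2-\Pi}{8}&\frac{2-\Pi}{4}&0\\0&0&0&\frac{\Pi}{4}\end{pmatrix}$$ in the ordered basis $|--\rangle,|-+\rangle,|+-\rangle,|++\rangle$. 3. $\lim_{t\to\infty}C(\rho(t))=C(\rho(\infty))=\max\{0,\frac{2-3\Pi}{4}\}$. Moreover, with $C(\infty)=C(\rho(\infty))$ and $\alpha\neq0$ fixed, $C(\infty)=0$ for all $\delta$ in some neighbourhood of $0$ (in particular $C(\infty)\to0$ as $\delta\to0$), and $C(\infty)\to\frac12$ as $\delta\to\infty$. -/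

import Mathlib

open MeasureTheory Filter Set
open scoped Topology Kronecker

noncomputable section

namespace SpinStar

/-! ### Spin operators -/

/-- Spin-`1/2` raising operator in the ordered basis `|−⟩` (index `0`), `|+⟩` (index `1`). -/
def spinPlus : Matrix (Fin 2) (Fin 2) ℂ := !![0, 0; 1, 0]

/-- Spin-`1/2` lowering operator. -/
def spinMinus : Matrix (Fin 2) (Fin 2) ℂ := !![0, 1; 0, 0]

/-- `z`-component of the spin-`1/2` operator. -/
def spinZ : Matrix (Fin 2) (Fin 2) ℂ := !![-(1 / 2), 0; 0, 1 / 2]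

/-- The Pauli matrix `σ_y = -i (S_+ - S_-)`. -/
def pauliY : Matrix (Fin 2) (Fin 2) ℂ := (-Complex.I) • (spinPlus - spinMinus)

/-- Basis of a bath of `N` spins-`1/2`, whose state space is `(ℂ²)^{⊗N}`. -/
abbrev Bath (N : ℕ) : Type := Fin N → Fin 2

/-- Basis `|−−⟩, |−+⟩, |+−⟩, |++⟩` of the two central qubits. -/
abbrev Qubits : Type := Fin 2 × Fin 2

/-- The one-spin operator `A` acting on the `k`-th spin of a bath, tensored with the identity on
all the others. -/
def siteOp {N : ℕ} (k : Fin N) (A : Matrix (Fin 2) (Fin 2) ℂ) : Matrix (Bath N) (Bath N) ℂ :=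
  Matrix.of fun σ τ => if ∀ l, l ≠ k → σ l = τ l then A (σ k) (τ k) else 0

/-- Total raising operator `J_+` of a bath. -/
def bathPlus (N : ℕ) : Matrix (Bath N) (Bath N) ℂ := ∑ k, siteOp k spinPlus

/-- Total lowering operator `J_-` of a bath. -/
def bathMinus (N : ℕ) : Matrix (Bath N) (Bath N) ℂ := ∑ k, siteOp k spinMinus

/-! ### Hamiltonian and reduced dynamics -/

/-- Basis of the composite system: two qubits, bath `B₁` of the first, bath `B₂` of the second. -/
abbrev Total (N : ℕ) : Type := Qubits × (Bath N × Bath N)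

/-- Ising interaction `4 δ S_z¹ S_z²` of the qubits. -/
def isingTerm (N : ℕ) (δ : ℝ) : Matrix (Total N) (Total N) ℂ :=
  (4 * δ : ℂ) • ((spinZ ⊗ₖ spinZ) ⊗ₖ (1 : Matrix (Bath N × Bath N) (Bath N × Bath N) ℂ))

/-- XY coupling `(α/√N) (S_+¹ J_- + S_-¹ J_+)` of the first qubit to the first bath. -/
def coupling₁ (N : ℕ) (α : ℝ) : Matrix (Total N) (Total N) ℂ :=
  ((α / √(N : ℝ) : ℝ) : ℂ) •
    ((spinPlus ⊗ₖ (1 : Matrix (Fin 2) (Fin 2) ℂ)) ⊗ₖ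
        (bathMinus N ⊗ₖ (1 : Matrix (Bath N) (Bath N) ℂ)) +
      (spinMinus ⊗ₖ (1 : Matrix (Fin 2) (Fin 2) ℂ)) ⊗ₖ
        (bathPlus N ⊗ₖ (1 : Matrix (Bath N) (Bath N) ℂ)))

/-- XY coupling of the second qubit to the second bath. -/
def coupling₂ (N : ℕ) (α : ℝ) : Matrix (Total N) (Total N) ℂ :=
  ((α / √(N : ℝ) : ℝ) : ℂ) •
    (((1 : Matrix (Fin 2) (Fin 2) ℂ) ⊗ₖ spinPlus) ⊗ₖ
        ((1 : Matrix (Bath N) (Bath N) ℂ) ⊗ₖ bathMinus N) +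
      ((1 : Matrix (Fin 2) (Fin 2) ℂ) ⊗ₖ spinMinus) ⊗ₖ
        ((1 : Matrix (Bath N) (Bath N) ℂ) ⊗ₖ bathPlus N))

/-- The full Hamiltonian. -/
def hamiltonian (N : ℕ) (α δ : ℝ) : Matrix (Total N) (Total N) ℂ :=
  isingTerm N δ + coupling₁ N α + coupling₂ N α

/-- Time evolution operator `U(t) = exp(-iHt)`. -/
def evolution (N : ℕ) (α δ t : ℝ) : Matrix (Total N) (Total N) ℂ :=
  NormedSpace.exp ((-(Complex.I * t)) • hamiltonian N α δ)

/-- Partial trace over the second tensor factor. -/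
def partialTrace {S B : Type} [Fintype B] (M : Matrix (S × B) (S × B) ℂ) : Matrix S S ℂ :=
  Matrix.of fun i j => ∑ b, M (i, b) (j, b)

/-- State vector of the singlet `(|−+⟩ − |+−⟩)/√2`. -/
def singletVec : Qubits → ℂ := fun q =>
  if q = (0, 1) then ((1 / √2 : ℝ) : ℂ) else if q = (1, 0) then -((1 / √2 : ℝ) : ℂ) else 0

/-- Density matrix of the singlet state. -/
def singletState : Matrix Qubits Qubits ℂ := Matrix.vecMulVec singletVec (star singletVec)

/-- Infinite-temperature state `𝟏 / 2^N` of a bath. -/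
def bathState (N : ℕ) : Matrix (Bath N) (Bath N) ℂ := ((2 : ℂ) ^ N)⁻¹ • 1

/-- Reduced density matrix `tr_{B₁+B₂}[U(t) (ρ(0) ⊗ 𝟏/2^N ⊗ 𝟏/2^N) U(t)†]` of the qubits,
for the initial state `ρ(0)`. -/
def reducedState (N : ℕ) (α δ : ℝ) (ρ₀ : Matrix Qubits Qubits ℂ) (t : ℝ) :
    Matrix Qubits Qubits ℂ :=
  partialTrace (evolution N α δ t * (ρ₀ ⊗ₖ (bathState N ⊗ₖ bathState N)) *
    (evolution N α δ t).conjTranspose)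

/-! ### Concurrence -/

/-- The operator `ρ (σ_y ⊗ σ_y) ρ* (σ_y ⊗ σ_y)`, with `ρ*` the entrywise complex conjugate. -/
def spinFlipProduct (ρ : Matrix Qubits Qubits ℂ) : Matrix Qubits Qubits ℂ :=
  ρ * (pauliY ⊗ₖ pauliY) * ρ.map (starRingEnd ℂ) * (pauliY ⊗ₖ pauliY)

/-- Square roots of the eigenvalues, with multiplicity, of `spinFlipProduct ρ`
(these eigenvalues are real and nonnegative when `ρ` is a density matrix). -/
def sqrtEigenvalues (ρ : Matrix Qubits Qubits ℂ) : Multiset ℝ :=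
  (spinFlipProduct ρ).charpoly.roots.map fun z => √z.re

/-- Concurrence `max {0, 2 max √λ_i - ∑ √λ_i}`. The fold computes the largest of the (nonnegative)
numbers `√λ_i`. -/
def concurrence (ρ : Matrix Qubits Qubits ℂ) : ℝ :=
  max 0 (2 * (sqrtEigenvalues ρ).fold max 0 - (sqrtEigenvalues ρ).sum)

/-! ### Thermodynamic limit -/

/-- Probability density `f(r) = 4 r e^{-2r²}`, `r ≥ 0`, of the limiting bath variable. -/
def bathDensity (r : ℝ) : ℝ := 4 * r * Real.exp (-2 * r ^ 2)

/-- The integral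
`∫₀^∞∫₀^∞ f(r) f(s) α²(r+εs)²/(δ²+α²(r+εs)²) sin²(t √(δ²+α²(r+εs)²)) dr ds`. -/
def lambdaIntegral (ε α δ t : ℝ) : ℝ :=
  ∫ r in Ioi (0 : ℝ), ∫ s in Ioi (0 : ℝ), bathDensity r * bathDensity s *
    (α ^ 2 * (r + ε * s) ^ 2 / (δ ^ 2 + α ^ 2 * (r + ε * s) ^ 2)) *
      Real.sin (t * √(δ ^ 2 + α ^ 2 * (r + ε * s) ^ 2)) ^ 2

/-- `Λ₊(t)`. -/
def lambdaPlus (α δ t : ℝ) : ℝ := lambdaIntegral 1 α δ t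

/-- `Λ₋(t)`. -/
def lambdaMinus (α δ t : ℝ) : ℝ := lambdaIntegral (-1) α δ t

/-- Probability density of `μ = r + s`, on `μ ≥ 0`. -/
def densityQ (μ : ℝ) : ℝ := ∫ r in (0 : ℝ)..μ, bathDensity (μ - r) * bathDensity r

/-- Probability density of `η = r - s`, on the real line; here `r = η + s` must be positive. -/
def densityR (η : ℝ) : ℝ := ∫ s in Ioi (max 0 (-η)), bathDensity (η + s) * bathDensity s

/-- `Λ₊(∞)`. -/
def lambdaPlusInf (α δ : ℝ) : ℝ :=
  1 / 2 * ∫ μ in Ioi (0 : ℝ), densityQ μ * (α ^ 2 * μ ^ 2 / (δ ^ 2 + α ^ 2 * μ ^ 2))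

/-- `Λ₋(∞)`. -/
def lambdaMinusInf (α δ : ℝ) : ℝ :=
  1 / 2 * ∫ η : ℝ, densityR η * (α ^ 2 * η ^ 2 / (δ ^ 2 + α ^ 2 * η ^ 2))

/-- `Π = Λ₊(∞) + Λ₋(∞)`. -/
def bigPi (α δ : ℝ) : ℝ := lambdaPlusInf α δ + lambdaMinusInf α δ

/-- The X-form matrix with parameter `P`, rows and columns ordered `−−, −+, +−, ++`. -/
def asymptoticState (P : ℝ) : Matrix Qubits Qubits ℂ :=
  (!![(P : ℂ) / 4, 0, 0, 0;
      0, (2 - P) / 4, -((2 - P) / 8), 0;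
      0, -((2 - P) / 8), (2 - P) / 4, 0;
      0, 0, 0, (P : ℂ) / 4]).submatrix finProdFinEquiv finProdFinEquiv

end SpinStar

end

/-!
Fix the two qubits and let the baths grow. Expanding both exponentials of the reduced dynamics, each
coefficient is a sum over words in the five terms of the Hamiltonian, and the bath enters only
through the normalized traces of words in `J₊/√N` and `J₋/√N`.

**Thermodynamic limit.** Adding one spin to a bath distributes the letters of a word over the new
spin and the old bath (`bathMoment_succ`). Only words with as many raising as lowering letters
survive, and to leading order the new spin takes no letter or a pair of opposite letters; by
Stolz–Cesàro the trace of a word with `k` letters of each kind is asymptotic to `k! (N/2) ^ k`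
(`tendsto_bathMoment_div_pow`), whatever the order of the letters. These are the moments of a
complex variable `r e^{iθ}` with uniform phase whose modulus has density `f`. The exponential
generating function `cosh(a)^N` of one collective spin bounds the moments uniformly in
`N`, so the limit may be taken termwise in the power series (`tendsto_reducedState_apply`).

**Classical bath variables.** Each qubit conserves `S_z + J_z` with its bath. Therefore the phases
`θ` do nothing but select the matrix elements of the initial state that contribute, and the rest is
an average over independent moduli `r`, `s` of the evolution generated by
`4δ S_z¹ S_z² + α r σ_x¹ + α s σ_x²` (`tendsto_reducedState_apply_integral`). This Hamiltonian
commutes with `σ_x ⊗ σ_x`; in the sector of parity `±1` it squares to `δ² + α² (r ± s)²`, so its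
exponential is explicit (`classicalEvolution_eq`). The limiting state of the singlet is an X-state
with two real parameters, a population and a coherence (`tendsto_reducedState_singlet`).

**Long times.** The population is `(Λ₊(t) + Λ₋(t)) / 4`; in it `sin²` may be replaced by `1/2` by
the Riemann–Lebesgue lemma, the frequency being taken as variable of integration
(`tendsto_integral_Ioi_exp_phase`). The coherence contains moreover a product of the amplitudes of
the two sectors. It averages to zero because, for a given sum `r + s`, the difference `r - s` still
has a density (`tendsto_integral_cross`).

**Concurrence.** For an X-state with diagonal `a, b, b, a` and coherence `-c`, where `0 ≤ c ≤ b` and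
`0 ≤ a`, the square roots of the eigenvalues in question are `a, a, b - c, b + c`, so that the
concurrence is `max 0 (2 (c - a))` (`concurrence_xState`). The limits in `δ` are those of `Π`, which
by dominated convergence tends to `1` as `δ → 0` and to `0` as `δ → ∞`.
-/

namespace SpinStar

/-! ### Splitting words into two complementary subwords -/

/-- All ways of distributing the letters of a word over an ordered pair of subwords, each keeping
the original order of its letters. -/
def splits {β : Type*} : List β → List (List β × List β)
  | [] => [([], [])]
  | b :: w => (splits w).map (fun p => (b :: p.1, p.2)) ++ (splits w).map (fun p => (p.1, b :: p.2))

/-- Sum of `F p q` over all splittings `(p, q)` of the word `w`. -/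
def splitSum {β R : Type*} [AddCommMonoid R] (w : List β) (F : List β → List β → R) : R :=
  ((splits w).map fun p => F p.1 p.2).sum

section SplitSum
variable {β R : Type*}

@[simp] lemma splitSum_nil [AddCommMonoid R] (F : List β → List β → R) :
    splitSum [] F = F [] [] := by
  simp [splitSum, splits]

lemma splitSum_cons [AddCommMonoid R] (b : β) (w : List β) (F : List β → List β → R) :
    splitSum (b :: w) F =
      splitSum w (fun p q => F (b :: p) q) + splitSum w (fun p q => F p (b :: q)) := by
  simp [splitSum, splits, Function.comp_def]

lemma splitSum_congr [AddCommMonoid R] [DecidableEq β] {w : List β} {F G : List β → List β → R}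
    (h : ∀ p q, (∀ b, p.count b + q.count b = w.count b) → F p q = G p q) :
    splitSum w F = splitSum w G := by
  induction w generalizing F G with
  | nil => simpa using h [] [] (by simp)
  | cons a w ih =>
    rw [splitSum_cons, splitSum_cons]
    congr 1
    · refine ih fun p q hpq => h _ _ fun b => ?_
      have := hpq b
      simp only [List.count_cons]
      omega
    · refine ih fun p q hpq => h _ _ fun b => ?_
      have := hpq b
      simp only [List.count_cons]
      omega

lemma splitSum_zero [AddCommMonoid R] (w : List β) :
    splitSum w (fun _ _ => (0 : R)) = 0 := by
  induction w with
  | nil => simp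
  | cons a w ih => rw [splitSum_cons, ih, add_zero]

lemma splitSum_mul_right [Semiring R] (w : List β) (F : List β → List β → R) (c : R) :
    splitSum w (fun p q => F p q * c) = splitSum w F * c := by
  induction w generalizing F with
  | nil => simp
  | cons a w ih => simp only [splitSum_cons, ih, add_mul]

lemma splitSum_map [AddCommMonoid R] {S : Type*} [AddCommMonoid S] (φ : R →+ S) (w : List β)
    (F : List β → List β → R) :
    φ (splitSum w F) = splitSum w fun p q => φ (F p q) := by
  induction w generalizing F with
  | nil => simp
  | cons a w ih => simp only [splitSum_cons, ih, map_add]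

lemma norm_splitSum_le [SeminormedAddCommGroup R] (w : List β) (F : List β → List β → R) :
    ‖splitSum w F‖ ≤ splitSum w fun p q => ‖F p q‖ := by
  induction w generalizing F with
  | nil => simp
  | cons a w ih =>
    simp only [splitSum_cons]
    exact (norm_add_le _ _).trans (add_le_add (ih _) (ih _))

lemma splitSum_le_splitSum [DecidableEq β] {w : List β} {F G : List β → List β → ℝ}
    (h : ∀ p q, (∀ b, p.count b + q.count b = w.count b) → F p q ≤ G p q) :
    splitSum w F ≤ splitSum w G := by
  induction w generalizing F G with
  | nil => simpa using h [] [] (by simp)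
  | cons a w ih =>
    rw [splitSum_cons, splitSum_cons]
    refine add_le_add (ih fun p q hpq => h _ _ fun b => ?_) (ih fun p q hpq => h _ _ fun b => ?_)
    all_goals
      have := hpq b
      simp only [List.count_cons]
      omega

lemma tendsto_splitSum [AddCommMonoid R] [TopologicalSpace R] [ContinuousAdd R] [DecidableEq β]
    {ι : Type*} {l : Filter ι} {w : List β} {F : ι → List β → List β → R}
    {G : List β → List β → R}
    (h : ∀ p q, (∀ b, p.count b + q.count b = w.count b) →
      Tendsto (fun i => F i p q) l (𝓝 (G p q))) :
    Tendsto (fun i => splitSum w (F i)) l (𝓝 (splitSum w G)) := by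
  induction w generalizing F G with
  | nil => simpa using h [] [] (by simp)
  | cons a w ih =>
    simp only [splitSum_cons]
    refine (ih fun p q hpq => h _ _ fun b => ?_).add (ih fun p q hpq => h _ _ fun b => ?_)
    all_goals
      have := hpq b
      simp only [List.count_cons]
      omega

/-- The number of splittings with prescribed lengths is a binomial coefficient. -/
lemma splitSum_length (w : List β) (F : ℕ → ℕ → ℝ) :
    splitSum w (fun p q => F p.length q.length) =
      ∑ ij ∈ Finset.HasAntidiagonal.antidiagonal w.length,
        (w.length.choose ij.1 : ℝ) * F ij.1 ij.2 := by
  induction w generalizing F with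
  | nil => simp
  | cons a w ih =>
    rw [splitSum_cons, List.length_cons, Finset.sum_antidiagonal_choose_succ_mul]
    simp only [List.length_cons]
    rw [ih (fun i j => F (i + 1) j), ih (fun i j => F i (j + 1)), add_comm]
    congr 1
    refine Finset.sum_congr rfl fun ij hij => ?_
    rw [Nat.choose_symm_of_eq_add (Finset.HasAntidiagonal.mem_antidiagonal.1 hij).symm]

/-- The splitting with empty first word, separated from the others. -/
lemma splitSum_eq_add_ne_nil [AddCommMonoid R] (w : List β)
    (F : List β → List β → R) :
    splitSum w F = F [] w + splitSum w (fun p q => if p.isEmpty then 0 else F p q) := by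
  induction w generalizing F with
  | nil => simp
  | cons a w ih =>
    rw [splitSum_cons, splitSum_cons, ih (fun p q => F p (a :: q))]
    simp only [List.isEmpty_cons, Bool.false_eq_true, if_false]
    abel

/-- A product of letters that act on one or the other of two tensor factors, expanded over the
splittings of the word. -/
lemma prod_kronecker_add {m n : Type*} [Fintype m] [DecidableEq m] [Fintype n] [DecidableEq n]
    (A : β → Matrix m m ℂ) (B : β → Matrix n n ℂ) (w : List β) :
    (w.map fun b => A b ⊗ₖ (1 : Matrix n n ℂ) + (1 : Matrix m m ℂ) ⊗ₖ B b).prod =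
      splitSum w fun p q => (p.map A).prod ⊗ₖ (q.map B).prod := by
  induction w with
  | nil => simp
  | cons a w ih =>
    rw [List.map_cons, List.prod_cons, ih, splitSum_cons, add_mul]
    have hl := splitSum_map (AddMonoidHom.mulLeft (A a ⊗ₖ (1 : Matrix n n ℂ))) w
      fun p q => (p.map A).prod ⊗ₖ (q.map B).prod
    have hr := splitSum_map (AddMonoidHom.mulLeft ((1 : Matrix m m ℂ) ⊗ₖ B a)) w
      fun p q => (p.map A).prod ⊗ₖ (q.map B).prod
    simp only [AddMonoidHom.coe_mulLeft] at hl hr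
    rw [hl, hr]
    simp only [← Matrix.mul_kronecker_mul, one_mul, List.map_cons, List.prod_cons]

end SplitSum

/-! ### Moments of the bath operators -/

/-- The ladder operators of one spin, indexed by the sign. -/
def spinLadder (b : Bool) : Matrix (Fin 2) (Fin 2) ℂ := if b then spinPlus else spinMinus

/-- The collective ladder operators of a bath, indexed by the sign. -/
def ladder (N : ℕ) (b : Bool) : Matrix (Bath N) (Bath N) ℂ := if b then bathPlus N else bathMinus N

/-- Expectation of a word in the ladder operators of one spin, in the maximally mixed state. -/
noncomputable def spinMoment (w : List Bool) : ℂ := 2⁻¹ * (w.map spinLadder).prod.trace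

/-- Expectation of a word in the collective ladder operators, in the maximally mixed state. -/
noncomputable def bathMoment (N : ℕ) (w : List Bool) : ℂ :=
  ((2 : ℂ) ^ N)⁻¹ * (w.map (ladder N)).prod.trace

lemma ladder_eq_sum (N : ℕ) (b : Bool) : ladder N b = ∑ k, siteOp k (spinLadder b) := by
  cases b <;> simp [ladder, spinLadder, bathPlus, bathMinus]

/-- The first spin of a bath of `N + 1` spins, separated from the others. -/
def bathSucc (N : ℕ) : Fin 2 × Bath N ≃ Bath (N + 1) := Fin.consEquiv fun _ => Fin 2

lemma siteOp_zero_submatrix (N : ℕ) (A : Matrix (Fin 2) (Fin 2) ℂ) :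
    (siteOp (0 : Fin (N + 1)) A).submatrix (bathSucc N) (bathSucc N) = A ⊗ₖ 1 := by
  ext ⟨x, σ⟩ ⟨y, τ⟩
  simp [siteOp, bathSucc, Fin.consEquiv, Fin.forall_fin_succ, Matrix.kroneckerMap_apply,
    Matrix.one_apply, funext_iff]

lemma siteOp_succ_submatrix (N : ℕ) (k : Fin N) (A : Matrix (Fin 2) (Fin 2) ℂ) :
    (siteOp k.succ A).submatrix (bathSucc N) (bathSucc N) = 1 ⊗ₖ siteOp k A := by
  ext ⟨x, σ⟩ ⟨y, τ⟩
  by_cases h : x = y <;>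
  simp [siteOp, bathSucc, Fin.consEquiv, Fin.forall_fin_succ, Matrix.kroneckerMap_apply, h,
    (Fin.succ_ne_zero k).symm]

lemma ladder_succ_submatrix (N : ℕ) (b : Bool) :
    (ladder (N + 1) b).submatrix (bathSucc N) (bathSucc N) =
      spinLadder b ⊗ₖ 1 + 1 ⊗ₖ ladder N b := by
  rw [ladder_eq_sum, Fin.sum_univ_succ, Matrix.submatrix_add, Pi.add_apply, Pi.add_apply,
    siteOp_zero_submatrix]
  congr 1
  have : (∑ i : Fin N, siteOp i.succ (spinLadder b)).submatrix (bathSucc N) (bathSucc N) =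
      ∑ i : Fin N, (siteOp i.succ (spinLadder b)).submatrix (bathSucc N) (bathSucc N) := by
    ext; simp [Matrix.sum_apply]
  rw [this, ladder_eq_sum]
  simp only [siteOp_succ_submatrix]
  ext ⟨x, σ⟩ ⟨y, τ⟩
  simp [Matrix.sum_apply, Matrix.kroneckerMap_apply, Finset.mul_sum]

/-- Adding one spin to the bath: each letter of the word acts either on the new spin or on the
old bath. -/
lemma bathMoment_succ (N : ℕ) (w : List Bool) :
    bathMoment (N + 1) w = splitSum w fun p q => spinMoment p * bathMoment N q := by
  have h1 : (w.map (ladder (N + 1))).prod.submatrix (bathSucc N) (bathSucc N) =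
      (w.map fun b => spinLadder b ⊗ₖ (1 : Matrix (Bath N) (Bath N) ℂ) +
        (1 : Matrix (Fin 2) (Fin 2) ℂ) ⊗ₖ ladder N b).prod := by
    induction w with
    | nil => simp
    | cons a w ih =>
      rw [List.map_cons, List.prod_cons, List.map_cons, List.prod_cons, ← ih,
        ← ladder_succ_submatrix, Matrix.submatrix_mul_equiv]
  have h2 : (w.map (ladder (N + 1))).prod.trace =
      splitSum w fun p q => (p.map spinLadder).prod.trace * (q.map (ladder N)).prod.trace := by
    have := congrArg Matrix.trace h1
    rw [prod_kronecker_add] at this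
    have h3 := splitSum_map (Matrix.traceAddMonoidHom (Fin 2 × Bath N) ℂ) w
      fun p q => (p.map spinLadder).prod ⊗ₖ (q.map (ladder N)).prod
    simp only [Matrix.traceAddMonoidHom_apply] at h3
    rw [h3] at this
    simp only [Matrix.trace_kronecker] at this
    rw [← this]
    simp only [Matrix.trace, Matrix.diag, Matrix.submatrix_apply]
    exact (Equiv.sum_comp (bathSucc N) fun x => (w.map (ladder (N + 1))).prod x x).symm
  rw [bathMoment, h2, mul_comm, ← splitSum_mul_right]
  congr 1
  ext p q
  rw [spinMoment, bathMoment, pow_succ, mul_inv]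
  ring

lemma bathMoment_zero (w : List Bool) : bathMoment 0 w = if w.isEmpty then 1 else 0 := by
  cases w with
  | nil => simp [bathMoment, Matrix.trace]
  | cons a w => simp [bathMoment, ladder_eq_sum]

lemma bathMoment_nil (N : ℕ) : bathMoment N [] = 1 := by
  simp [bathMoment, Matrix.trace]

/-- A word in the ladder operators of one spin has entries of modulus at most one, and changes the
spin state by its excess of raising over lowering letters. -/
lemma spinWord_apply (w : List Bool) (i j : Fin 2) :
    ‖(w.map spinLadder).prod i j‖ ≤ 1 ∧
      ((i : ℕ) + w.count false ≠ j + w.count true → (w.map spinLadder).prod i j = 0) := by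
  induction w generalizing i with
  | nil =>
    fin_cases i <;> fin_cases j <;> simp
  | cons a w ih =>
    have h0 := ih 0
    have h1 := ih 1
    rw [List.map_cons, List.prod_cons, Matrix.mul_apply, Fin.sum_univ_two]
    cases a <;> fin_cases i <;>
      simp [spinLadder, spinPlus, spinMinus] at h0 h1 ⊢
    · exact ⟨h1.1, fun h => h1.2 (by omega)⟩
    · exact ⟨h0.1, fun h => h0.2 (by omega)⟩

lemma norm_spinMoment_le (w : List Bool) : ‖spinMoment w‖ ≤ 1 := by
  rw [spinMoment, Matrix.trace_fin_two, norm_mul]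
  have h0 := (spinWord_apply w 0 0).1
  have h1 := (spinWord_apply w 1 1).1
  have := norm_add_le ((w.map spinLadder).prod 0 0) ((w.map spinLadder).prod 1 1)
  norm_num
  linarith

lemma spinMoment_eq_zero {w : List Bool} (h : w.count true ≠ w.count false) :
    spinMoment w = 0 := by
  rw [spinMoment, Matrix.trace_fin_two, (spinWord_apply w 0 0).2 (by simpa using h.symm),
    (spinWord_apply w 1 1).2 (by simpa using h.symm)]
  simp

lemma spinMoment_nil : spinMoment [] = 1 := by
  simp [spinMoment]

lemma spinMoment_pair (a b : Bool) : spinMoment [a, b] = if a = b then 0 else 2⁻¹ := by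
  cases a <;> cases b <;>
    simp [spinMoment, spinLadder, spinPlus, spinMinus, Matrix.trace_fin_two]

lemma count_true_add_count_false (w : List Bool) : w.count true + w.count false = w.length := by
  induction w with
  | nil => rfl
  | cons a w ih => cases a <;> simp <;> omega

lemma spinMoment_eq_zero_of_odd {w : List Bool} (h : ¬ Even w.length) : spinMoment w = 0 := by
  refine spinMoment_eq_zero fun he => h ⟨w.count true, ?_⟩
  rw [← count_true_add_count_false w, he]

/-- Only words with as many raising as lowering letters have a nonzero expectation. -/
lemma bathMoment_eq_zero {N : ℕ} {w : List Bool} (h : w.count true ≠ w.count false) :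
    bathMoment N w = 0 := by
  induction N generalizing w with
  | zero =>
    rw [bathMoment_zero, if_neg]
    cases w <;> simp_all
  | succ N ih =>
    rw [bathMoment_succ, ← splitSum_zero w]
    refine splitSum_congr fun p q hpq => ?_
    have ht := hpq true
    have hf := hpq false
    by_cases hp : p.count true = p.count false
    · rw [ih (w := q) (by omega), mul_zero]
    · rw [spinMoment_eq_zero hp, zero_mul]

/-- The even part of the exponential series is dominated by `cosh`. -/
lemma sum_even_pow_div_factorial_le (a : ℝ) (ha : 0 ≤ a) (n : ℕ) :
    ∑ j ∈ Finset.range n, (if Even j then a ^ j / j.factorial else 0) ≤ Real.cosh a := by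
  have h1 := NormedSpace.expSeries_div_hasSum_exp (𝔸 := ℝ) a
  have h2 := NormedSpace.expSeries_div_hasSum_exp (𝔸 := ℝ) (-a)
  rw [← Real.exp_eq_exp_ℝ] at h1 h2
  have h3 := (h1.add h2).div_const 2
  rw [← Real.cosh_eq] at h3
  have h4 : ∀ j : ℕ, (a ^ j / j.factorial + (-a) ^ j / j.factorial) / 2 =
      if Even j then a ^ j / j.factorial else 0 := by
    intro j
    split_ifs with hj
    · rw [hj.neg_pow]; ring
    · rw [(Nat.not_even_iff_odd.1 hj).neg_pow]; ring
  simp only [h4] at h3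
  refine sum_le_hasSum _ (fun j _ => ?_) h3
  split_ifs <;> positivity

/-- Moment bound by the exponential generating function `cosh(a)^N` of the collective spin. -/
lemma norm_bathMoment_le (N : ℕ) (w : List Bool) {a : ℝ} (ha : 0 < a) :
    ‖bathMoment N w‖ ≤ w.length.factorial / a ^ w.length * Real.cosh a ^ N := by
  induction N generalizing w with
  | zero =>
    rw [bathMoment_zero]
    split_ifs with h
    · rw [List.isEmpty_iff.1 h]; simp
    · simp only [norm_zero]; positivity
  | succ N ih =>
    set n := w.length with hn
    let F : ℕ → ℕ → ℝ := fun i j =>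
      (if Even i then 1 else 0) * (j.factorial / a ^ j * Real.cosh a ^ N)
    have h1 : ‖bathMoment (N + 1) w‖ ≤ splitSum w fun p q => F p.length q.length := by
      rw [bathMoment_succ]
      refine (norm_splitSum_le _ _).trans (splitSum_le_splitSum fun p q _ => ?_)
      rw [norm_mul]
      refine mul_le_mul ?_ (ih q) (norm_nonneg _) (by positivity)
      split_ifs with hp
      · exact norm_spinMoment_le p
      · rw [spinMoment_eq_zero_of_odd hp, norm_zero]
    refine h1.trans ?_
    rw [splitSum_length, ← hn, Finset.Nat.sum_antidiagonal_eq_sum_range_succ_mk]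
    have h2 : ∀ j ∈ Finset.range n.succ, (n.choose j : ℝ) * F j (n - j) =
        n.factorial / a ^ n * Real.cosh a ^ N *
          (if Even j then a ^ j / j.factorial else 0) := by
      intro j hj
      have hj' : j ≤ n := by simpa [Nat.lt_succ_iff] using hj
      simp only [F]
      split_ifs
      · rw [Nat.cast_choose ℝ hj', ← Nat.sub_add_cancel hj', pow_add, Nat.add_sub_cancel]
        field_simp
      · simp
    rw [Finset.sum_congr rfl h2, ← Finset.mul_sum, pow_succ, ← mul_assoc]
    exact mul_le_mul_of_nonneg_left (sum_even_pow_div_factorial_le a ha.le _) (by positivity)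

/-! ### Gaussian limit of the bath moments -/

/-- Stolz–Cesàro: increments of order `n ^ k` sum up to order `n ^ (k + 1)`. -/
lemma tendsto_div_pow_succ_of_increments {x : ℕ → ℂ} {k : ℕ} {c : ℂ}
    (h : Tendsto (fun n : ℕ => (x (n + 1) - x n) / (n : ℂ) ^ k) atTop (𝓝 c)) :
    Tendsto (fun n : ℕ => x n / (n : ℂ) ^ (k + 1)) atTop (𝓝 (c / (k + 1))) := by
  let g : ℕ → ℝ := fun n => ((n : ℝ) + 1) ^ (k + 1) - (n : ℝ) ^ (k + 1)
  have hg0 : ∀ n, 0 ≤ g n := fun n => by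
    simp only [g, sub_nonneg]
    gcongr
    linarith
  have hgsum : ∀ n, ∑ i ∈ Finset.range n, g i = (n : ℝ) ^ (k + 1) := by
    intro n
    have := Finset.sum_range_sub (fun i : ℕ => (i : ℝ) ^ (k + 1)) n
    simpa [g] using this
  have hpow : Tendsto (fun n : ℕ => (n : ℝ) ^ (k + 1)) atTop atTop :=
    (tendsto_pow_atTop (Nat.succ_ne_zero k)).comp tendsto_natCast_atTop_atTop
  -- `(n + 1) ^ (k + 1) - n ^ (k + 1)` is asymptotic to `(k + 1) n ^ k`
  have hratio : Tendsto (fun n : ℕ => g n / (n : ℝ) ^ k) atTop (𝓝 (k + 1)) := by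
    have hd : HasDerivAt (fun y : ℝ => y ^ (k + 1)) ((k : ℝ) + 1) 1 := by
      simpa using hasDerivAt_pow (k + 1) (1 : ℝ)
    have h1 := hd.tendsto_slope_zero_right
    have h2 : Tendsto (fun n : ℕ => ((n : ℝ))⁻¹) atTop (𝓝[>] 0) :=
      tendsto_inv_atTop_nhdsGT_zero.comp tendsto_natCast_atTop_atTop
    refine (h1.comp h2).congr' ?_
    filter_upwards [eventually_gt_atTop 0] with n hn
    have hn' : (n : ℝ) ≠ 0 := by positivity
    have h3 : 1 + (n : ℝ)⁻¹ = (n + 1) / n := by field_simp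
    simp only [Function.comp, inv_inv, smul_eq_mul, one_pow, g, h3, div_pow]
    field_simp
    ring
  have hgO : (fun n : ℕ => (n : ℝ) ^ k) =O[atTop] g := by
    have h3 : Tendsto (fun n : ℕ => (n : ℝ) ^ k / g n) atTop (𝓝 ((k : ℝ) + 1)⁻¹) := by
      refine (hratio.inv₀ (by positivity)).congr fun n => ?_
      rw [inv_div]
    refine Asymptotics.isBigO_of_div_tendsto_nhds ?_ _ h3
    filter_upwards [eventually_gt_atTop 0] with n hn hgn
    exfalso
    have : (n : ℝ) ^ (k + 1) < ((n : ℝ) + 1) ^ (k + 1) := by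
      gcongr
      linarith
    simp only [g] at hgn
    linarith
  have hlo : (fun n : ℕ => (x (n + 1) - x n) - c / (k + 1) * (g n : ℂ)) =o[atTop] g := by
    refine Asymptotics.IsLittleO.trans_isBigO ?_ hgO
    rw [← Asymptotics.isLittleO_norm_right]
    have h4 : Tendsto (fun n : ℕ => ((g n / (n : ℝ) ^ k : ℝ) : ℂ)) atTop
        (𝓝 (((k : ℝ) + 1 : ℝ) : ℂ)) :=
      (Complex.continuous_ofReal.tendsto _).comp hratio
    have h5 := h.sub (h4.const_mul (c / (k + 1)))
    have hk : ((k : ℂ) + 1) ≠ 0 := Nat.cast_add_one_ne_zero k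
    have h6 : c - c / (k + 1) * (((k : ℝ) + 1 : ℝ) : ℂ) = 0 := by
      push_cast
      field_simp
      ring
    rw [h6] at h5
    have h7 : (fun n : ℕ => (x (n + 1) - x n) - c / (k + 1) * (g n : ℂ)) =o[atTop]
        fun n : ℕ => (n : ℂ) ^ k := by
      refine (Asymptotics.isLittleO_iff_tendsto' ?_).2 (h5.congr fun n => ?_)
      · filter_upwards [eventually_gt_atTop 0] with n hn h0
        exact absurd h0 (pow_ne_zero _ (by exact_mod_cast hn.ne'))
      · push_cast
        ring
    refine h7.trans_isBigO ?_
    refine Asymptotics.IsBigO.of_bound 1 (Eventually.of_forall fun n => ?_)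
    simp
  have hsum := hlo.sum_range hg0 (by simpa only [hgsum] using hpow)
  simp only [hgsum] at hsum
  have hxs : ∀ n, ∑ i ∈ Finset.range n, ((x (i + 1) - x i) - c / (k + 1) * (g i : ℂ)) =
      x n - x 0 - c / (k + 1) * (n : ℂ) ^ (k + 1) := by
    intro n
    rw [Finset.sum_sub_distrib, Finset.sum_range_sub, ← Finset.mul_sum, ← Complex.ofReal_sum,
      hgsum]
    push_cast
    ring
  simp only [hxs] at hsum
  have h8 : (fun n : ℕ => x n - x 0 - c / (k + 1) * (n : ℂ) ^ (k + 1)) =o[atTop]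
      fun n : ℕ => (n : ℂ) ^ (k + 1) := by
    refine hsum.trans_isBigO (Asymptotics.IsBigO.of_bound 1 (Eventually.of_forall fun n => ?_))
    simp
  have h9 := h8.tendsto_div_nhds_zero
  have h10 : Tendsto (fun n : ℕ => x 0 / (n : ℂ) ^ (k + 1)) atTop (𝓝 0) := by
    rw [tendsto_zero_iff_norm_tendsto_zero]
    simpa using hpow.const_div_atTop ‖x 0‖
  have h11 := (h9.add h10).add_const (c / (k + 1))
  simp only [zero_add] at h11
  refine h11.congr' ?_
  filter_upwards [eventually_gt_atTop 0] with n hn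
  have : (n : ℂ) ≠ 0 := by exact_mod_cast hn.ne'
  field_simp
  ring

lemma splitSum_isEmpty {β : Type*} (w : List β) :
    splitSum w (fun p _ => if p.isEmpty then (1 : ℂ) else 0) = 1 := by
  induction w with
  | nil => simp
  | cons a w ih =>
    rw [splitSum_cons, ih]
    simp [splitSum_zero]

lemma splitSum_singleton {β : Type*} [DecidableEq β] (b : β) (w : List β) :
    splitSum w (fun p _ => if p = [b] then (1 : ℂ) else 0) = w.count b := by
  induction w with
  | nil => simp
  | cons a w ih =>
    rw [splitSum_cons, ih, List.count_cons]
    by_cases h : a = b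
    · subst h
      have := splitSum_isEmpty w
      simp only [List.isEmpty_iff] at this
      simp [this, add_comm]
    · simp [h, splitSum_zero]

/-- The pairs of letters with nonzero one-spin expectation are the pairs of opposite letters. -/
lemma splitSum_spinMoment_pair (w : List Bool) :
    splitSum w (fun p _ => if p.length = 2 then spinMoment p else 0) =
      2⁻¹ * (w.count true * w.count false) := by
  induction w with
  | nil => simp
  | cons a w ih =>
    rw [splitSum_cons, ih]
    have h : splitSum w (fun p _ => if (a :: p).length = 2 then spinMoment (a :: p) else 0) =
        2⁻¹ * w.count !a := by
      rw [← splitSum_singleton, mul_comm, ← splitSum_mul_right]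
      refine splitSum_congr fun p q _ => ?_
      rcases p with _ | ⟨b, _ | ⟨c, p⟩⟩
      · simp
      · cases a <;> cases b <;> simp [spinMoment_pair]
      · simp
    rw [h]
    cases a <;> simp <;> ring

/-- In the thermodynamic limit the rescaled collective ladder operators have the moments of a
complex Gaussian variable and its conjugate, whatever the order of the letters. -/
lemma tendsto_bathMoment_div_pow (k : ℕ) (w : List Bool) (ht : w.count true = k)
    (hf : w.count false = k) :
    Tendsto (fun N : ℕ => bathMoment N w / (N : ℂ) ^ k) atTop
      (𝓝 (k.factorial / (2 : ℂ) ^ k)) := by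
  induction k using Nat.strong_induction_on generalizing w with
  | _ k ih =>
  rcases k with _ | k
  · have hw : w = [] := by
      have := count_true_add_count_false w
      exact List.eq_nil_of_length_eq_zero (by omega)
    simp [hw, bathMoment_nil]
  · set κ : ℂ := k.factorial / (2 : ℂ) ^ k with hκ
    have key : Tendsto (fun N : ℕ => (bathMoment (N + 1) w - bathMoment N w) / (N : ℂ) ^ k) atTop
        (𝓝 (2⁻¹ * (w.count true * w.count false) * κ)) := by
      rw [← splitSum_spinMoment_pair, ← splitSum_mul_right]
      have h1 : ∀ N : ℕ, (bathMoment (N + 1) w - bathMoment N w) / (N : ℂ) ^ k =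
          splitSum w fun p q =>
            (if p.isEmpty then 0 else spinMoment p * bathMoment N q) * ((N : ℂ) ^ k)⁻¹ := by
        intro N
        rw [bathMoment_succ, splitSum_eq_add_ne_nil, spinMoment_nil, one_mul, add_sub_cancel_left,
          splitSum_mul_right, div_eq_mul_inv]
      simp only [h1]
      refine tendsto_splitSum fun p q hpq => ?_
      have hpt := hpq true
      have hpf := hpq false
      have hlen := count_true_add_count_false p
      rw [ht] at hpt
      rw [hf] at hpf
      by_cases hp : p.count true = p.count false
      · obtain ⟨j, hj⟩ : ∃ j, j = p.count true := ⟨_, rfl⟩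
        have hqt : q.count true = k + 1 - j := by omega
        have hqf : q.count false = k + 1 - j := by omega
        -- `p` has `2 j` letters; only the words with `j = 1` contribute to the order `N ^ k`
        rcases j with _ | _ | j
        · have : p = [] := List.eq_nil_of_length_eq_zero (by omega)
          simp [this]
        · have h2 : p.length = 2 := by omega
          have h3 : p.isEmpty = false := by
            cases p <;> simp_all
          have := (ih k (by omega) q (by omega) (by omega)).const_mul (spinMoment p)
          simp only [h2, h3, Bool.false_eq_true, if_false, if_true]
          refine this.congr fun N => ?_
          rw [div_eq_mul_inv, mul_assoc]
        · have h2 : p.length ≠ 2 := by omega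
          have h3 : p.isEmpty = false := by
            cases p <;> simp_all
          have := (ih (k + 1 - (j + 1 + 1)) (by omega) q hqt hqf).const_mul (spinMoment p)
          have hz : Tendsto (fun N : ℕ => ((N : ℂ)⁻¹) ^ (j + 1)) atTop (𝓝 0) := by
            have := (tendsto_inv_atTop_nhds_zero_nat (𝕜 := ℂ)).pow (j + 1)
            simpa using this
          have h4 := this.mul hz
          simp only [mul_zero] at h4
          simp only [h2, h3, Bool.false_eq_true, if_false, zero_mul]
          refine h4.congr' ?_
          filter_upwards [eventually_gt_atTop 0] with N hN
          have hN' : (N : ℂ) ≠ 0 := by exact_mod_cast hN.ne'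
          obtain ⟨i, hi⟩ : ∃ i, k = i + j + 1 := ⟨k - (j + 1), by omega⟩
          have h5 : k + 1 - (j + 1 + 1) = i := by omega
          rw [h5, hi, add_assoc, pow_add, inv_pow]
          field_simp
          ring
      · simp only [spinMoment_eq_zero hp, zero_mul, ite_self]
        exact tendsto_const_nhds
    have := tendsto_div_pow_succ_of_increments (x := fun N => bathMoment N w) key
    convert this using 2
    rw [ht, hf, hκ, Nat.factorial_succ, pow_succ]
    have hk : ((k : ℂ) + 1) ≠ 0 := Nat.cast_add_one_ne_zero k
    push_cast
    field_simp

/-- Law of the modulus of the limiting bath variable: the measure with density `f` on `(0, ∞)`. -/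
noncomputable def bathLaw : Measure ℝ :=
  (volume.restrict (Ioi (0 : ℝ))).withDensity fun r => ENNReal.ofReal (bathDensity r)

lemma bathDensity_nonneg {r : ℝ} (hr : 0 ≤ r) : 0 ≤ bathDensity r := by
  unfold bathDensity; positivity

@[fun_prop] lemma continuous_bathDensity : Continuous bathDensity := by
  unfold bathDensity; fun_prop

lemma integral_bathLaw {E : Type*} [NormedAddCommGroup E] [NormedSpace ℝ E] (g : ℝ → E) :
    ∫ r, g r ∂bathLaw = ∫ r in Ioi (0 : ℝ), bathDensity r • g r := by
  rw [bathLaw, integral_withDensity_eq_integral_toReal_smul (by fun_prop)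
    (Eventually.of_forall fun _ => ENNReal.ofReal_lt_top)]
  refine setIntegral_congr_fun measurableSet_Ioi fun r hr => ?_
  rw [ENNReal.toReal_ofReal (bathDensity_nonneg (le_of_lt hr))]

lemma integral_bathDensity_mul_pow (k : ℕ) :
    ∫ r in Ioi (0 : ℝ), bathDensity r * r ^ (2 * k) = k.factorial / 2 ^ k := by
  have h := integral_rpow_mul_exp_neg_mul_rpow (p := 2) (q := 2 * k + 1) (b := 2) (by norm_num)
    (by have : (0 : ℝ) ≤ k := k.cast_nonneg
        linarith) (by norm_num)
  have h1 : ∫ r in Ioi (0 : ℝ), bathDensity r * r ^ (2 * k) =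
      4 * ∫ r in Ioi (0 : ℝ), r ^ (2 * (k : ℝ) + 1) * Real.exp (-2 * r ^ (2 : ℝ)) := by
    rw [← integral_const_mul]
    refine setIntegral_congr_fun measurableSet_Ioi fun r hr => ?_
    have h2 : r ^ (2 * (k : ℝ) + 1) = r ^ (2 * k + 1) := by
      rw [← Real.rpow_natCast]
      push_cast
      rfl
    simp only [h2, Real.rpow_two, bathDensity]
    ring
  have h3 : (2 * (k : ℝ) + 1 + 1) / 2 = k + 1 := by ring
  have h4 : -(2 * (k : ℝ) + 1 + 1) / 2 = -((k + 1 : ℕ) : ℝ) := by push_cast; ring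
  rw [h1, h, h3, h4, Real.Gamma_nat_eq_factorial, Real.rpow_neg (by norm_num), Real.rpow_natCast,
    pow_succ]
  field_simp
  norm_num

lemma integral_bathLaw_pow (k : ℕ) : ∫ r, r ^ (2 * k) ∂bathLaw = k.factorial / 2 ^ k := by
  rw [integral_bathLaw]
  exact integral_bathDensity_mul_pow k

lemma integrableOn_bathDensity : IntegrableOn bathDensity (Ioi 0) := by
  -- otherwise the integral would have the value `0` instead of `1`
  by_contra h
  have h1 := integral_bathDensity_mul_pow 0
  simp only [mul_zero, pow_zero, mul_one] at h1
  rw [integral_undef h] at h1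
  simp at h1

instance isProbabilityMeasure_bathLaw : IsProbabilityMeasure bathLaw := by
  constructor
  rw [bathLaw, withDensity_apply _ MeasurableSet.univ, Measure.restrict_univ,
    ← ofReal_integral_eq_lintegral_ofReal integrableOn_bathDensity]
  · have h1 := integral_bathDensity_mul_pow 0
    simp only [mul_zero, pow_zero, mul_one] at h1
    simp [h1]
  · filter_upwards [ae_restrict_mem measurableSet_Ioi] with r hr
    exact bathDensity_nonneg (le_of_lt hr)

/-- Limit of the rescaled expectation of a word in the collective ladder operators: the moment
`E[r ^ |w| e^{i θ (#₊ - #₋)}]` of a complex variable `r e^{i θ}` with uniform phase `θ`. -/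
noncomputable def limitMoment (w : List Bool) : ℝ :=
  if w.count true = w.count false then ∫ r, r ^ w.length ∂bathLaw else 0

lemma tendsto_bathMoment (w : List Bool) :
    Tendsto (fun N : ℕ => ((1 / √(N : ℝ) : ℝ) : ℂ) ^ w.length * bathMoment N w) atTop
      (𝓝 (limitMoment w)) := by
  by_cases h : w.count true = w.count false
  · obtain ⟨k, hk⟩ : ∃ k, k = w.count true := ⟨_, rfl⟩
    have hlen : w.length = 2 * k := by
      have := count_true_add_count_false w
      omega
    rw [limitMoment, if_pos h, hlen, integral_bathLaw_pow]
    have := tendsto_bathMoment_div_pow k w hk.symm (by omega)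
    push_cast
    refine this.congr fun N => ?_
    have h2 : ((√(N : ℝ) : ℝ) : ℂ) ^ 2 = N := by
      rw [← Complex.ofReal_pow, Real.sq_sqrt (Nat.cast_nonneg N)]
      simp
    rw [pow_mul, div_pow, h2, div_pow, one_pow, one_pow]
    ring
  · simp only [bathMoment_eq_zero h, mul_zero, limitMoment, if_neg h, Complex.ofReal_zero]
    exact tendsto_const_nhds

/-- Bound on the rescaled moments that is uniform in the size of the bath. -/
lemma norm_rescaled_bathMoment_le (N : ℕ) (w : List Bool) {a : ℝ} (ha : 0 < a) :
    ‖((1 / √(N : ℝ) : ℝ) : ℂ) ^ w.length * bathMoment N w‖ ≤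
      w.length.factorial / a ^ w.length * Real.exp (a ^ 2 / 2) := by
  rcases Nat.eq_zero_or_pos N with rfl | hN
  · rw [bathMoment_zero]
    split_ifs with h
    · rw [List.isEmpty_iff.1 h]
      simp
      positivity
    · simp only [mul_zero, norm_zero]
      positivity
  · have hs : 0 < √(N : ℝ) := Real.sqrt_pos.2 (by exact_mod_cast hN)
    have h1 := norm_bathMoment_le N w (a := a / √N) (by positivity)
    have h2 : Real.cosh (a / √N) ^ N ≤ Real.exp (a ^ 2 / 2) := by
      calc Real.cosh (a / √N) ^ N ≤ Real.exp ((a / √N) ^ 2 / 2) ^ N := by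
            gcongr
            exact Real.cosh_le_exp_half_sq _
        _ = Real.exp (a ^ 2 / 2) := by
            rw [← Real.exp_nat_mul, div_pow, Real.sq_sqrt (Nat.cast_nonneg N)]
            congr 1
            field_simp
    rw [norm_mul, norm_pow, Complex.norm_real, Real.norm_of_nonneg (by positivity)]
    calc (1 / √(N : ℝ)) ^ w.length * ‖bathMoment N w‖
        ≤ (1 / √(N : ℝ)) ^ w.length *
          (w.length.factorial / (a / √N) ^ w.length * Real.exp (a ^ 2 / 2)) := by
          gcongr
          exact h1.trans (by gcongr)
      _ = w.length.factorial / a ^ w.length * Real.exp (a ^ 2 / 2) := by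
          rw [div_pow, div_pow, one_pow]
          field_simp

/-! ### Expansion of the reduced dynamics in words -/

/-- Letters of the Hamiltonian: `none` is the Ising term; `some (i, b)` is the term in which the
bath `i` (`false` for the first, `true` for the second) is acted on by its ladder operator of
sign `b`, and the qubit `i` by the one of opposite sign. -/
abbrev Letter : Type := Option (Bool × Bool)

/-- Qubit factor of a letter, with the coupling constants included. -/
noncomputable def qubitLetter (α δ : ℝ) : Letter → Matrix Qubits Qubits ℂ
  | none => (4 * δ : ℂ) • (spinZ ⊗ₖ spinZ)
  | some (false, b) => (α : ℂ) • (spinLadder (!b) ⊗ₖ 1)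
  | some (true, b) => (α : ℂ) • (1 ⊗ₖ spinLadder (!b))

/-- Bath factor of a letter, with the factor `1/√N` included. -/
noncomputable def bathLetter (N : ℕ) : Letter → Matrix (Bath N × Bath N) (Bath N × Bath N) ℂ
  | none => 1
  | some (false, b) => ((1 / √(N : ℝ) : ℝ) : ℂ) • (ladder N b ⊗ₖ 1)
  | some (true, b) => ((1 / √(N : ℝ) : ℝ) : ℂ) • (1 ⊗ₖ ladder N b)

lemma hamiltonian_eq_sum (N : ℕ) (α δ : ℝ) :
    hamiltonian N α δ = ∑ l, qubitLetter α δ l ⊗ₖ bathLetter N l := by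
  rw [Fintype.sum_option, Fintype.sum_prod_type, Fintype.sum_bool, Fintype.sum_bool,
    Fintype.sum_bool]
  simp only [qubitLetter, bathLetter, hamiltonian, isingTerm, coupling₁, coupling₂, ladder,
    spinLadder, Matrix.smul_kronecker, Matrix.kronecker_smul, Bool.not_true, Bool.not_false,
    if_true, Bool.false_eq_true, if_false, smul_smul, smul_add]
  have h : ((α / √(N : ℝ) : ℝ) : ℂ) = (α : ℂ) * ((1 / √(N : ℝ) : ℝ) : ℂ) := by
    push_cast; ring
  simp only [h, mul_comm (((1 / √(N : ℝ) : ℝ) : ℂ))]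
  abel

/-- Letters of a word that act on the bath `i`. -/
def subword (i : Bool) (w : List Letter) : List Bool :=
  w.filterMap fun l => l.bind fun p => if p.1 = i then some p.2 else none

lemma subword_append (i : Bool) (v w : List Letter) :
    subword i (v ++ w) = subword i v ++ subword i w := List.filterMap_append

lemma prod_bathLetter (N : ℕ) (w : List Letter) :
    (w.map (bathLetter N)).prod =
      (((1 / √(N : ℝ) : ℝ) : ℂ) ^ (subword false w).length *
        ((1 / √(N : ℝ) : ℝ) : ℂ) ^ (subword true w).length) •
        (((subword false w).map (ladder N)).prod ⊗ₖ ((subword true w).map (ladder N)).prod) := by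
  induction w with
  | nil => simp [subword]
  | cons l w ih =>
    rw [List.map_cons, List.prod_cons, ih]
    rcases l with _ | ⟨_ | _, b⟩
    · simp [bathLetter, subword]
    · simp only [bathLetter, subword, List.filterMap_cons, Option.bind_some, if_true,
        Bool.false_eq_true, if_false, List.length_cons, List.map_cons, List.prod_cons,
        smul_mul_smul_comm, ← Matrix.mul_kronecker_mul, one_mul]
      congr 1
      ring
    · simp only [bathLetter, subword, List.filterMap_cons, Option.bind_some, if_true,
        Bool.true_eq_false, if_false, List.length_cons, List.map_cons, List.prod_cons,
        smul_mul_smul_comm, ← Matrix.mul_kronecker_mul, one_mul]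
      congr 1
      ring

/-- Expectation of the bath factor of a word, in the maximally mixed state of the two baths. -/
noncomputable def wordMoment (N : ℕ) (w : List Letter) : ℂ :=
  ((2 : ℂ) ^ N)⁻¹ * ((2 : ℂ) ^ N)⁻¹ * (w.map (bathLetter N)).prod.trace

lemma wordMoment_eq (N : ℕ) (w : List Letter) :
    wordMoment N w =
      (((1 / √(N : ℝ) : ℝ) : ℂ) ^ (subword false w).length * bathMoment N (subword false w)) *
      (((1 / √(N : ℝ) : ℝ) : ℂ) ^ (subword true w).length * bathMoment N (subword true w)) := by
  rw [wordMoment, prod_bathLetter, Matrix.trace_smul, Matrix.trace_kronecker, bathMoment,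
    bathMoment, smul_eq_mul]
  ring

/-- A power of a sum, expanded in words, without commutativity. -/
lemma sum_pow_eq_sum_words {R ι : Type*} [Semiring R] [Fintype ι] (X : ι → R) (n : ℕ) :
    (∑ i, X i) ^ n = ∑ v : Fin n → ι, ((List.ofFn v).map X).prod := by
  induction n with
  | zero => simp
  | succ n ih =>
    rw [pow_succ', ih, Finset.sum_mul_sum, ← Fintype.sum_prod_type',
      ← Equiv.sum_comp (Fin.consEquiv fun _ : Fin (n + 1) => ι)]
    simp [Fin.consEquiv, List.ofFn_succ]

lemma prod_map_kronecker {ι m n : Type*} [Fintype m] [DecidableEq m] [Fintype n] [DecidableEq n]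
    (A : ι → Matrix m m ℂ) (B : ι → Matrix n n ℂ) (w : List ι) :
    (w.map fun i => A i ⊗ₖ B i).prod = (w.map A).prod ⊗ₖ (w.map B).prod := by
  induction w with
  | nil => simp
  | cons a w ih =>
    rw [List.map_cons, List.prod_cons, ih, ← Matrix.mul_kronecker_mul]
    simp

/-- The coefficient of the double power series of the reduced dynamics, for the bath expectation
`φ` of words: the sum of `φ(v w) Q_v ρ₀ Q_w` over words `v`, `w` of lengths `n`, `m`. -/
def wordSum (Q : Letter → Matrix Qubits Qubits ℂ) (ρ₀ : Matrix Qubits Qubits ℂ)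
    (φ : List Letter → ℂ) (n m : ℕ) : Matrix Qubits Qubits ℂ :=
  ∑ v : Fin n → Letter, ∑ w : Fin m → Letter, φ (List.ofFn v ++ List.ofFn w) •
    (((List.ofFn v).map Q).prod * ρ₀ * ((List.ofFn w).map Q).prod)

lemma partialTrace_sum {S B ι : Type} [Fintype B] (s : Finset ι)
    (M : ι → Matrix (S × B) (S × B) ℂ) :
    partialTrace (∑ i ∈ s, M i) = ∑ i ∈ s, partialTrace (M i) := by
  ext a b
  simp only [partialTrace, Matrix.of_apply, Matrix.sum_apply]
  exact Finset.sum_comm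

lemma partialTrace_kronecker {S B : Type} [Fintype B] (X : Matrix S S ℂ) (Y : Matrix B B ℂ) :
    partialTrace (X ⊗ₖ Y) = Y.trace • X := by
  ext a b
  simp [partialTrace, Matrix.kroneckerMap_apply, Matrix.trace, Finset.mul_sum, mul_comm]

lemma bathState_kronecker (N : ℕ) :
    bathState N ⊗ₖ bathState N = (((2 : ℂ) ^ N)⁻¹ * ((2 : ℂ) ^ N)⁻¹) •
      (1 : Matrix (Bath N × Bath N) (Bath N × Bath N) ℂ) := by
  simp [bathState, Matrix.smul_kronecker, Matrix.kronecker_smul, smul_smul]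

lemma partialTrace_pow_hamiltonian (N : ℕ) (α δ : ℝ) (ρ₀ : Matrix Qubits Qubits ℂ) (n m : ℕ) :
    partialTrace (hamiltonian N α δ ^ n * (ρ₀ ⊗ₖ (bathState N ⊗ₖ bathState N)) *
      hamiltonian N α δ ^ m) = wordSum (qubitLetter α δ) ρ₀ (wordMoment N) n m := by
  rw [hamiltonian_eq_sum, sum_pow_eq_sum_words, sum_pow_eq_sum_words, Finset.sum_mul,
    Finset.sum_mul, partialTrace_sum, wordSum]
  refine Finset.sum_congr rfl fun v _ => ?_
  rw [Finset.mul_sum, partialTrace_sum]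
  refine Finset.sum_congr rfl fun w _ => ?_
  rw [prod_map_kronecker, prod_map_kronecker, ← Matrix.mul_kronecker_mul,
    ← Matrix.mul_kronecker_mul, partialTrace_kronecker, bathState_kronecker, wordMoment,
    List.map_append, List.prod_append]
  simp [Matrix.trace_smul]

lemma conjTranspose_siteOp {N : ℕ} (k : Fin N) (A : Matrix (Fin 2) (Fin 2) ℂ) :
    (siteOp k A).conjTranspose = siteOp k A.conjTranspose := by
  ext σ τ
  simp only [siteOp, Matrix.conjTranspose_apply, Matrix.of_apply]
  rw [apply_ite star, star_zero]
  simp only [eq_comm]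

lemma conjTranspose_spinLadder (b : Bool) : (spinLadder b).conjTranspose = spinLadder (!b) := by
  ext i j
  cases b <;> fin_cases i <;> fin_cases j <;> simp [spinLadder, spinPlus, spinMinus]

lemma conjTranspose_ladder (N : ℕ) (b : Bool) : (ladder N b).conjTranspose = ladder N (!b) := by
  rw [ladder_eq_sum, ladder_eq_sum, Matrix.conjTranspose_sum]
  simp only [conjTranspose_siteOp, conjTranspose_spinLadder]

lemma conjTranspose_spinZ : spinZ.conjTranspose = spinZ := by
  ext i j
  fin_cases i <;> fin_cases j <;> simp [spinZ]

lemma isHermitian_hamiltonian (N : ℕ) (α δ : ℝ) : (hamiltonian N α δ).IsHermitian := by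
  have hp : (bathPlus N).conjTranspose = bathMinus N := conjTranspose_ladder N true
  have hm : (bathMinus N).conjTranspose = bathPlus N := conjTranspose_ladder N false
  have sp : spinPlus.conjTranspose = spinMinus := conjTranspose_spinLadder true
  have sm : spinMinus.conjTranspose = spinPlus := conjTranspose_spinLadder false
  rw [Matrix.IsHermitian, hamiltonian, isingTerm, coupling₁, coupling₂]
  simp only [Matrix.conjTranspose_add, Matrix.conjTranspose_smul, Matrix.conjTranspose_kronecker,
    Matrix.conjTranspose_one, hp, hm, sp, sm, conjTranspose_spinZ, Complex.star_def,
    Complex.conj_ofReal, map_mul, Complex.conj_ofNat]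
  rw [add_comm ((spinMinus ⊗ₖ 1) ⊗ₖ _), add_comm ((1 ⊗ₖ spinMinus) ⊗ₖ _)]

lemma conjTranspose_evolution (N : ℕ) (α δ t : ℝ) :
    (evolution N α δ t).conjTranspose =
      NormedSpace.exp ((Complex.I * t) • hamiltonian N α δ) := by
  rw [evolution, ← Matrix.exp_conjTranspose, Matrix.conjTranspose_smul,
    (isHermitian_hamiltonian N α δ).eq]
  simp

/-- Coefficients of the exponential series of `z X`. -/
noncomputable def expCoeff (z : ℂ) (n : ℕ) : ℂ := (n.factorial : ℂ)⁻¹ * z ^ n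

lemma hasSum_exp_smul {𝔸 : Type*} [NormedRing 𝔸] [NormedAlgebra ℂ 𝔸] [CompleteSpace 𝔸]
    (z : ℂ) (x : 𝔸) : HasSum (fun n => expCoeff z n • x ^ n) (NormedSpace.exp (z • x)) := by
  have key : ∀ n : ℕ, (n.factorial : ℂ)⁻¹ • (z • x) ^ n = expCoeff z n • x ^ n :=
    fun n => by rw [smul_pow, smul_smul, expCoeff]
  simpa only [key] using NormedSpace.exp_series_hasSum_exp' (𝕂 := ℂ) (z • x)

/-- The double power series of `exp (z x) r exp (z' x)` in a Banach algebra. -/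
lemma hasSum_exp_mul_mul_exp {𝔸 : Type*} [NormedRing 𝔸] [NormedAlgebra ℂ 𝔸] [CompleteSpace 𝔸]
    (z z' : ℂ) (x r : 𝔸) :
    HasSum (fun p : ℕ × ℕ => (expCoeff z p.1 * expCoeff z' p.2) • (x ^ p.1 * r * x ^ p.2))
      (NormedSpace.exp (z • x) * r * NormedSpace.exp (z' • x)) := by
  have key : ∀ (z : ℂ) (n : ℕ), (n.factorial : ℂ)⁻¹ • (z • x) ^ n = expCoeff z n • x ^ n :=
    fun z n => by rw [smul_pow, smul_smul, expCoeff]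
  have h1 (z : ℂ) := hasSum_exp_smul z x
  have h2 (z : ℂ) : Summable fun n => ‖expCoeff z n • x ^ n‖ := by
    simpa only [key] using NormedSpace.norm_expSeries_summable' (𝕂 := ℂ) (z • x)
  have h3 : Summable fun n => ‖expCoeff z n • x ^ n * r‖ :=
    Summable.of_nonneg_of_le (fun _ => norm_nonneg _) (fun _ => norm_mul_le _ _)
      ((h2 z).mul_right ‖r‖)
  have h4 := summable_mul_of_summable_norm (f := fun n => expCoeff z n • x ^ n * r)
    (g := fun n => expCoeff z' n • x ^ n) h3 (h2 z')
  have h5 := HasSum.mul (f := fun n => expCoeff z n • x ^ n * r)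
    (g := fun n => expCoeff z' n • x ^ n) ((h1 z).mul_right r) (h1 z') h4
  simp only [smul_mul_assoc, mul_smul_comm, smul_smul, mul_comm (expCoeff z' _)] at h5
  exact h5

lemma continuous_partialTrace {S B : Type} [Fintype B] :
    Continuous (partialTrace : Matrix (S × B) (S × B) ℂ → Matrix S S ℂ) := by
  refine continuous_matrix fun i j => ?_
  simp only [partialTrace, Matrix.of_apply]
  fun_prop

section OperatorNorm
open scoped Matrix.Norms.Operator

lemma hasSum_exp_smul_matrix {m : Type*} [Fintype m] [DecidableEq m] (z : ℂ) (X : Matrix m m ℂ) :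
    HasSum (fun n => expCoeff z n • X ^ n) (NormedSpace.exp (z • X)) :=
  hasSum_exp_smul z X

lemma hasSum_sandwich {m : Type*} [Fintype m] [DecidableEq m] (z z' : ℂ) (X R : Matrix m m ℂ) :
    HasSum (fun p : ℕ × ℕ => (expCoeff z p.1 * expCoeff z' p.2) • (X ^ p.1 * R * X ^ p.2))
      (NormedSpace.exp (z • X) * R * NormedSpace.exp (z' • X)) :=
  hasSum_exp_mul_mul_exp z z' X R

lemma norm_prod_le_pow {ι m : Type*} [Fintype m] [DecidableEq m] [Nonempty m]
    (Q : ι → Matrix m m ℂ) {C : ℝ}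
    (hC : ∀ i, ‖Q i‖ ≤ C) (w : List ι) : ‖(w.map Q).prod‖ ≤ C ^ w.length := by
  induction w with
  | nil => simp
  | cons a w ih =>
    rw [List.map_cons, List.prod_cons, List.length_cons, pow_succ']
    exact (norm_mul_le _ _).trans
      (mul_le_mul (hC a) ih (norm_nonneg _) ((norm_nonneg _).trans (hC a)))

lemma norm_entry_le {m : Type*} [Fintype m] [DecidableEq m] (X : Matrix m m ℂ) (i j : m) :
    ‖X i j‖ ≤ ‖X‖ := by
  rw [Matrix.linfty_opNorm_def]
  have h1 : ‖X i j‖₊ ≤ ∑ j, ‖X i j‖₊ :=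
    Finset.single_le_sum (f := fun j => ‖X i j‖₊) (fun _ _ => zero_le) (Finset.mem_univ j)
  exact_mod_cast h1.trans (Finset.le_sup (f := fun i => ∑ j, ‖X i j‖₊) (Finset.mem_univ i))

end OperatorNorm

lemma hasSum_reducedState (N : ℕ) (α δ : ℝ) (ρ₀ : Matrix Qubits Qubits ℂ) (t : ℝ) :
    HasSum (fun p : ℕ × ℕ => (expCoeff (-(Complex.I * t)) p.1 * expCoeff (Complex.I * t) p.2) •
      wordSum (qubitLetter α δ) ρ₀ (wordMoment N) p.1 p.2) (reducedState N α δ ρ₀ t) := by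
  have h := hasSum_sandwich (-(Complex.I * t)) (Complex.I * t) (hamiltonian N α δ)
    (ρ₀ ⊗ₖ (bathState N ⊗ₖ bathState N))
  let P : Matrix (Total N) (Total N) ℂ →+ Matrix Qubits Qubits ℂ :=
    { toFun := partialTrace
      map_zero' := by ext; simp [partialTrace]
      map_add' := fun x y => by ext; simp [partialTrace, Finset.sum_add_distrib] }
  have h2 := h.map P continuous_partialTrace
  rw [reducedState, conjTranspose_evolution, evolution]
  have h3 : ∀ p : ℕ × ℕ, P ((expCoeff (-(Complex.I * t)) p.1 * expCoeff (Complex.I * t) p.2) •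
      (hamiltonian N α δ ^ p.1 * (ρ₀ ⊗ₖ (bathState N ⊗ₖ bathState N)) *
        hamiltonian N α δ ^ p.2)) =
      (expCoeff (-(Complex.I * t)) p.1 * expCoeff (Complex.I * t) p.2) •
        wordSum (qubitLetter α δ) ρ₀ (wordMoment N) p.1 p.2 := by
    intro p
    rw [← partialTrace_pow_hamiltonian]
    ext i j
    simp [P, partialTrace, Finset.mul_sum]
  simp only [Function.comp_def, h3] at h2
  exact h2

/-! ### Thermodynamic limit -/

/-- Limit of `wordMoment N w`: the two baths become independent classical variables. -/
noncomputable def limitWordMoment (w : List Letter) : ℂ :=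
  limitMoment (subword false w) * limitMoment (subword true w)

lemma tendsto_wordMoment (w : List Letter) :
    Tendsto (fun N : ℕ => wordMoment N w) atTop (𝓝 (limitWordMoment w)) := by
  simp only [wordMoment_eq]
  exact (tendsto_bathMoment _).mul (tendsto_bathMoment _)

lemma length_subword_add_le (w : List Letter) :
    (subword false w).length + (subword true w).length ≤ w.length := by
  induction w with
  | nil => simp [subword]
  | cons l w ih =>
    simp only [subword] at ih
    rcases l with _ | ⟨_ | _, b⟩ <;> simp [subword] <;> omega

lemma norm_wordMoment_le (N : ℕ) (w : List Letter) {a : ℝ} (ha : 0 < a) :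
    ‖wordMoment N w‖ ≤ w.length.factorial / a ^ w.length * Real.exp (a ^ 2 + a) := by
  obtain ⟨n₁, h₁⟩ : ∃ n, n = (subword false w).length := ⟨_, rfl⟩
  obtain ⟨n₂, h₂⟩ : ∃ n, n = (subword true w).length := ⟨_, rfl⟩
  obtain ⟨n₀, h₀⟩ : ∃ n, w.length = n₁ + n₂ + n :=
    ⟨w.length - (n₁ + n₂), by have := length_subword_add_le w; omega⟩
  have b₁ := norm_rescaled_bathMoment_le N (subword false w) ha
  have b₂ := norm_rescaled_bathMoment_le N (subword true w) ha
  rw [← h₁] at b₁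
  rw [← h₂] at b₂
  have hf : (n₁.factorial : ℝ) * n₂.factorial * n₀.factorial ≤ (n₁ + n₂ + n₀).factorial := by
    have i₁ := Nat.le_of_dvd (Nat.factorial_pos _)
      (Nat.factorial_mul_factorial_dvd_factorial_add n₁ n₂)
    have i₂ := Nat.le_of_dvd (Nat.factorial_pos _)
      (Nat.factorial_mul_factorial_dvd_factorial_add (n₁ + n₂) n₀)
    exact_mod_cast (Nat.mul_le_mul_right _ i₁).trans i₂
  have hexp : a ^ n₀ ≤ n₀.factorial * Real.exp a := by
    have := Real.pow_div_factorial_le_exp a ha.le n₀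
    rwa [div_le_iff₀' (by positivity)] at this
  rw [wordMoment_eq, norm_mul, ← h₁, ← h₂, h₀]
  calc _ ≤ (n₁.factorial / a ^ n₁ * Real.exp (a ^ 2 / 2)) *
        (n₂.factorial / a ^ n₂ * Real.exp (a ^ 2 / 2)) :=
        mul_le_mul b₁ b₂ (norm_nonneg _) (by positivity)
    _ = n₁.factorial * n₂.factorial * a ^ n₀ / a ^ (n₁ + n₂ + n₀) * Real.exp (a ^ 2) := by
        rw [pow_add, pow_add]
        have : Real.exp (a ^ 2) = Real.exp (a ^ 2 / 2) * Real.exp (a ^ 2 / 2) := by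
          rw [← Real.exp_add]; ring_nf
        rw [this]
        field_simp
    _ ≤ (n₁.factorial * n₂.factorial * (n₀.factorial * Real.exp a)) / a ^ (n₁ + n₂ + n₀) *
          Real.exp (a ^ 2) := by gcongr
    _ = (n₁.factorial * n₂.factorial * n₀.factorial) / a ^ (n₁ + n₂ + n₀) *
          Real.exp (a ^ 2 + a) := by
        rw [Real.exp_add]; ring
    _ ≤ (n₁ + n₂ + n₀).factorial / a ^ (n₁ + n₂ + n₀) * Real.exp (a ^ 2 + a) := by gcongr

section OperatorNorm
open scoped Matrix.Norms.Operator

lemma norm_wordSum_apply_le {Q : Letter → Matrix Qubits Qubits ℂ} {C : ℝ} (hC : ∀ l, ‖Q l‖ ≤ C)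
    (ρ₀ : Matrix Qubits Qubits ℂ) {φ : List Letter → ℂ} {n m : ℕ} {K : ℝ}
    (hφ : ∀ w : List Letter, w.length = n + m → ‖φ w‖ ≤ K) (i j : Qubits) :
    ‖wordSum Q ρ₀ φ n m i j‖ ≤ K * ‖ρ₀‖ * (5 * C) ^ (n + m) := by
  have hC0 : 0 ≤ C := (norm_nonneg _).trans (hC none)
  have hcard (k : ℕ) : ((Finset.univ : Finset (Fin k → Letter)).card : ℝ) = 5 ^ k := by
    simp [Fintype.card_option]
  have hterm : ∀ (v : Fin n → Letter) (w : Fin m → Letter),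
      ‖φ (List.ofFn v ++ List.ofFn w) •
        (((List.ofFn v).map Q).prod * ρ₀ * ((List.ofFn w).map Q).prod)‖ ≤
        K * ‖ρ₀‖ * C ^ (n + m) := by
    intro v w
    have hv := norm_prod_le_pow Q hC (List.ofFn v)
    have hw := norm_prod_le_pow Q hC (List.ofFn w)
    rw [List.length_ofFn] at hv hw
    have hK := hφ (List.ofFn v ++ List.ofFn w) (by simp)
    calc _ ≤ ‖φ (List.ofFn v ++ List.ofFn w)‖ * (‖((List.ofFn v).map Q).prod‖ * ‖ρ₀‖ *
          ‖((List.ofFn w).map Q).prod‖) := by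
          rw [norm_smul]
          gcongr
          exact (norm_mul_le _ _).trans (by gcongr; exact norm_mul_le _ _)
      _ ≤ K * (C ^ n * ‖ρ₀‖ * C ^ m) := by
          have := (norm_nonneg _).trans hK
          gcongr
      _ = K * ‖ρ₀‖ * C ^ (n + m) := by rw [pow_add]; ring
  refine (norm_entry_le _ i j).trans ?_
  rw [wordSum]
  calc _ ≤ ∑ v : Fin n → Letter, ∑ w : Fin m → Letter, K * ‖ρ₀‖ * C ^ (n + m) :=
        (norm_sum_le _ _).trans (Finset.sum_le_sum fun v _ =>
          (norm_sum_le _ _).trans (Finset.sum_le_sum fun w _ => hterm v w))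
    _ = K * ‖ρ₀‖ * (5 * C) ^ (n + m) := by
        rw [Finset.sum_const, Finset.sum_const, nsmul_eq_mul, nsmul_eq_mul, hcard, hcard,
          mul_pow, pow_add]
        ring

/-- Tannery's theorem for the double power series: the bath moments grow at most like
`k! / a ^ k` for every `a`, uniformly in the size of the bath. -/
lemma tendsto_reducedState_apply (α δ : ℝ) (ρ₀ : Matrix Qubits Qubits ℂ) (t : ℝ) (i j : Qubits) :
    Tendsto (fun N : ℕ => reducedState N α δ ρ₀ t i j) atTop
      (𝓝 (∑' p : ℕ × ℕ, expCoeff (-(Complex.I * t)) p.1 * expCoeff (Complex.I * t) p.2 *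
        wordSum (qubitLetter α δ) ρ₀ limitWordMoment p.1 p.2 i j)) := by
  obtain ⟨C, hC⟩ : ∃ C : ℝ, ∀ l, ‖qubitLetter α δ l‖ ≤ C := by
    obtain ⟨C, hC⟩ := (Set.finite_range fun l => ‖qubitLetter α δ l‖).bddAbove
    exact ⟨C, fun l => hC ⟨l, rfl⟩⟩
  have hC0 : 0 ≤ C := (norm_nonneg _).trans (hC none)
  -- `a` is so large that each letter contributes at most `1/4`
  set a : ℝ := 20 * (C + 1) * (|t| + 1) with ha_def
  have ha : 0 < a := by positivity
  have hx : |t| * (5 * C) / a ≤ 1 / 4 := by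
    rw [div_le_div_iff₀ ha (by norm_num), ha_def]
    have := abs_nonneg t
    nlinarith [mul_nonneg this hC0]
  set M : ℝ := Real.exp (a ^ 2 + a) * ‖ρ₀‖
  have hsum : ∀ N : ℕ, reducedState N α δ ρ₀ t i j =
      ∑' p : ℕ × ℕ, expCoeff (-(Complex.I * t)) p.1 * expCoeff (Complex.I * t) p.2 *
        wordSum (qubitLetter α δ) ρ₀ (wordMoment N) p.1 p.2 i j := by
    intro N
    have h := hasSum_reducedState N α δ ρ₀ t
    have h2 := Pi.hasSum.1 (Pi.hasSum.1 h i) j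
    exact h2.tsum_eq.symm
  simp only [hsum]
  refine tendsto_tsum_of_dominated_convergence
    (bound := fun p : ℕ × ℕ => M * ((1 / 2) ^ p.1 * (1 / 2) ^ p.2)) ?_ ?_ ?_
  · refine Summable.mul_left _ ?_
    have hg : Summable fun n : ℕ => ((1 : ℝ) / 2) ^ n := summable_geometric_two
    exact hg.mul_of_nonneg hg (fun _ => by positivity) (fun _ => by positivity)
  · intro p
    refine Tendsto.const_mul _ ?_
    simp only [wordSum, Matrix.sum_apply, Matrix.smul_apply]
    exact tendsto_finsetSum _ fun v _ => tendsto_finsetSum _ fun w _ =>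
      (tendsto_wordMoment _).smul_const _
  · refine Eventually.of_forall fun N p => ?_
    obtain ⟨n, m⟩ := p
    have h1 := norm_wordSum_apply_le hC ρ₀ (φ := wordMoment N) (n := n) (m := m)
      (K := (n + m).factorial / a ^ (n + m) * Real.exp (a ^ 2 + a))
      (fun w hw => by have := norm_wordMoment_le N w ha; rwa [hw] at this) i j
    have hch : ((n + m).factorial : ℝ) ≤ 2 ^ (n + m) * n.factorial * m.factorial := by
      rw [← Nat.add_choose_mul_factorial_mul_factorial n m]
      push_cast
      gcongr
      exact_mod_cast Nat.choose_le_two_pow _ _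
    have he (z : ℂ) (hz : ‖z‖ = |t|) (k : ℕ) : ‖expCoeff z k‖ = |t| ^ k / k.factorial := by
      rw [expCoeff, norm_mul, norm_inv, norm_pow, hz, Complex.norm_natCast]
      ring
    rw [norm_mul, norm_mul, he _ (by simp), he _ (by simp)]
    calc _ ≤ |t| ^ n / n.factorial * (|t| ^ m / m.factorial) *
          ((n + m).factorial / a ^ (n + m) * Real.exp (a ^ 2 + a) * ‖ρ₀‖ * (5 * C) ^ (n + m)) := by
          gcongr
      _ ≤ |t| ^ n / n.factorial * (|t| ^ m / m.factorial) *
          (2 ^ (n + m) * n.factorial * m.factorial / a ^ (n + m) * Real.exp (a ^ 2 + a) * ‖ρ₀‖ *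
            (5 * C) ^ (n + m)) := by gcongr
      _ = M * (2 * (|t| * (5 * C) / a)) ^ (n + m) := by
          simp only [M, mul_pow, div_pow, pow_add]
          field_simp
      _ ≤ M * (1 / 2) ^ (n + m) := by
          gcongr
          linarith
      _ = M * ((1 / 2) ^ n * (1 / 2) ^ m) := by rw [pow_add]

end OperatorNorm

/-! ### The limit as an average over classical bath variables -/

/-- The spin-flip matrix `S₊ + S₋`. -/
def spinFlip : Matrix (Fin 2) (Fin 2) ℂ := spinPlus + spinMinus

/-- The Hamiltonian of the two qubits when the rescaled bath operators are replaced by the real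
numbers `r` and `s`. -/
noncomputable def classicalHamiltonian (α δ r s : ℝ) : Matrix Qubits Qubits ℂ :=
  (4 * δ : ℂ) • (spinZ ⊗ₖ spinZ) + (α * r : ℂ) • (spinFlip ⊗ₖ 1) + (α * s : ℂ) • (1 ⊗ₖ spinFlip)

/-- Value of the bath factor of a letter at the classical bath variables `r` and `s`. -/
def classicalLetter (r s : ℝ) : Letter → ℂ
  | none => 1
  | some (false, _) => r
  | some (true, _) => s

lemma classicalHamiltonian_eq_sum (α δ r s : ℝ) :
    classicalHamiltonian α δ r s = ∑ l, classicalLetter r s l • qubitLetter α δ l := by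
  rw [Fintype.sum_option, Fintype.sum_prod_type, Fintype.sum_bool, Fintype.sum_bool,
    Fintype.sum_bool]
  simp only [qubitLetter, classicalLetter, classicalHamiltonian, spinFlip, spinLadder,
    Matrix.add_kronecker, Matrix.kronecker_add, Bool.not_true, Bool.not_false,
    if_true, Bool.false_eq_true, if_false, smul_smul, smul_add, one_mul, mul_comm (α : ℂ)]
  abel

lemma prod_classicalLetter (α δ r s : ℝ) (w : List Letter) :
    (w.map fun l => classicalLetter r s l • qubitLetter α δ l).prod =
      ((r : ℂ) ^ (subword false w).length * (s : ℂ) ^ (subword true w).length) •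
        (w.map (qubitLetter α δ)).prod := by
  induction w with
  | nil => simp [subword]
  | cons l w ih =>
    rw [List.map_cons, List.prod_cons, ih]
    rw [smul_mul_smul_comm]
    rcases l with _ | ⟨_ | _, b⟩ <;>
      simp [classicalLetter, subword] <;> ring_nf

lemma classicalHamiltonian_pow (α δ r s : ℝ) (n : ℕ) :
    classicalHamiltonian α δ r s ^ n = ∑ v : Fin n → Letter,
      ((r : ℂ) ^ (subword false (List.ofFn v)).length *
        (s : ℂ) ^ (subword true (List.ofFn v)).length) •
        ((List.ofFn v).map (qubitLetter α δ)).prod := by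
  rw [classicalHamiltonian_eq_sum, sum_pow_eq_sum_words]
  simp only [prod_classicalLetter]

/-- Conservation of `S_z + J_z` of each qubit and its bath: a word connects two qubit states only
if their difference is the excess of lowering over raising letters of the baths. -/
lemma qubitWord_apply_eq_zero (α δ : ℝ) (w : List Letter) (i a : Qubits)
    (h : ¬ ((i.1 : ℕ) + (subword false w).count true = a.1 + (subword false w).count false ∧
      (i.2 : ℕ) + (subword true w).count true = a.2 + (subword true w).count false)) :
    (w.map (qubitLetter α δ)).prod i a = 0 := by
  induction w generalizing i with
  | nil =>
    have : i ≠ a := by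
      rintro rfl
      simp [subword] at h
    simp [this]
  | cons l w ih =>
    rw [List.map_cons, List.prod_cons, Matrix.mul_apply]
    refine Finset.sum_eq_zero fun c _ => ?_
    by_contra hne
    rw [mul_eq_zero, not_or] at hne
    obtain ⟨h1, h2⟩ := hne
    have h3 := not_not.1 fun hn => h2 (ih c hn)
    apply h
    obtain ⟨i1, i2⟩ := i
    obtain ⟨c1, c2⟩ := c
    rcases l with _ | ⟨_ | _, _ | _⟩ <;>
    simp only [subword, List.filterMap_cons, Option.bind_none, Option.bind_some, if_true,
      Bool.true_eq_false, Bool.false_eq_true, if_false, List.count_cons] at h3 ⊢ <;>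
    fin_cases i1 <;> fin_cases i2 <;> fin_cases c1 <;> fin_cases c2 <;>
    simp [qubitLetter, spinZ, spinLadder, spinPlus, spinMinus, Matrix.kroneckerMap_apply]
      at h1 h3 ⊢ <;>
    omega

/-- Whether the matrix element `i j` of the reduced state can depend on the element `a b` of the
initial state: the two sides have to lose the same amount of each `S_z`. -/
def SameCharge (i a b j : Qubits) : Prop :=
  (i.1 : ℕ) + b.1 = a.1 + j.1 ∧ (i.2 : ℕ) + b.2 = a.2 + j.2

instance (i a b j : Qubits) : Decidable (SameCharge i a b j) :=
  inferInstanceAs (Decidable (_ ∧ _))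

lemma integrable_bathLaw_iff {E : Type*} [NormedAddCommGroup E] [NormedSpace ℝ E] {g : ℝ → E} :
    Integrable g bathLaw ↔ IntegrableOn (fun r => bathDensity r • g r) (Ioi 0) := by
  rw [bathLaw, integrable_withDensity_iff_integrable_smul' (by fun_prop)
    (Eventually.of_forall fun _ => ENNReal.ofReal_lt_top)]
  refine integrableOn_congr_fun (fun r hr => ?_) measurableSet_Ioi
  rw [ENNReal.toReal_ofReal (bathDensity_nonneg (le_of_lt hr))]

/-- The bath variable has exponential moments of all orders. -/
lemma integrable_exp_mul_abs_bathLaw (c : ℝ) :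
    Integrable (fun r => Real.exp (c * |r|)) bathLaw := by
  rw [integrable_bathLaw_iff]
  have h := ((integrable_mul_exp_neg_mul_sq (b := 1) one_pos).const_mul
    (4 * Real.exp (c ^ 2 / 4))).integrableOn (s := Ioi 0)
  refine Integrable.mono' h (by fun_prop) ?_
  filter_upwards [ae_restrict_mem measurableSet_Ioi] with r hr
  have hr' : 0 < r := hr
  rw [smul_eq_mul, abs_of_pos hr', Real.norm_of_nonneg
    (mul_nonneg (bathDensity_nonneg hr'.le) (Real.exp_pos _).le), bathDensity]
  calc 4 * r * Real.exp (-2 * r ^ 2) * Real.exp (c * r)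
      = 4 * r * Real.exp (-2 * r ^ 2 + c * r) := by rw [Real.exp_add]; ring
    _ ≤ 4 * r * Real.exp (c ^ 2 / 4 + -1 * r ^ 2) := by
        refine mul_le_mul_of_nonneg_left (Real.exp_le_exp.2 ?_) (by positivity)
        nlinarith [sq_nonneg (r - c / 2)]
    _ = 4 * Real.exp (c ^ 2 / 4) * (r * Real.exp (-1 * r ^ 2)) := by rw [Real.exp_add]; ring

lemma integrable_pow_bathLaw (n : ℕ) : Integrable (fun r : ℝ => r ^ n) bathLaw := by
  refine Integrable.mono' ((integrable_exp_mul_abs_bathLaw 1).const_mul (n.factorial : ℝ))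
    (by fun_prop) (Eventually.of_forall fun r => ?_)
  rw [norm_pow, Real.norm_eq_abs, one_mul, ← div_le_iff₀' (by positivity)]
  exact Real.pow_div_factorial_le_exp _ (abs_nonneg r) n

/-- Law of the pair of limiting bath variables. -/
noncomputable abbrev bathPairLaw : Measure (ℝ × ℝ) := bathLaw.prod bathLaw

lemma integrable_pow_mul_pow (n m : ℕ) :
    Integrable (fun p : ℝ × ℝ => (p.1 : ℂ) ^ n * (p.2 : ℂ) ^ m) bathPairLaw := by
  have h := (Integrable.mul_prod (integrable_pow_bathLaw n)
    (integrable_pow_bathLaw m)).ofReal (𝕜 := ℂ)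
  refine h.congr (Eventually.of_forall fun p => ?_)
  push_cast
  rfl

lemma integral_pow_mul_pow (n m : ℕ) :
    ∫ p : ℝ × ℝ, (p.1 : ℂ) ^ n * (p.2 : ℂ) ^ m ∂bathPairLaw =
      ((∫ r, r ^ n ∂bathLaw : ℝ) : ℂ) * ((∫ r, r ^ m ∂bathLaw : ℝ) : ℂ) := by
  rw [integral_prod_mul (fun r : ℝ => (r : ℂ) ^ n) (fun r : ℝ => (r : ℂ) ^ m),
    ← integral_complex_ofReal, ← integral_complex_ofReal]
  push_cast
  rfl

/-- By charge conservation the phase average in `limitWordMoment` is a selection rule that does not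
depend on the words. -/
lemma limitWordMoment_mul (α δ : ℝ) (v w : List Letter) (i a b j : Qubits) :
    limitWordMoment (v ++ w) * ((v.map (qubitLetter α δ)).prod i a *
        (w.map (qubitLetter α δ)).prod b j) =
      if SameCharge i a b j then
        (∫ p : ℝ × ℝ, (p.1 : ℂ) ^ (subword false (v ++ w)).length *
          (p.2 : ℂ) ^ (subword true (v ++ w)).length ∂bathPairLaw) *
        ((v.map (qubitLetter α δ)).prod i a * (w.map (qubitLetter α δ)).prod b j)
      else 0 := by
  by_cases hv : (v.map (qubitLetter α δ)).prod i a = 0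
  · simp [hv]
  by_cases hw : (w.map (qubitLetter α δ)).prod b j = 0
  · simp [hw]
  have h1 := not_not.1 fun hn => hv (qubitWord_apply_eq_zero α δ v i a hn)
  have h2 := not_not.1 fun hn => hw (qubitWord_apply_eq_zero α δ w b j hn)
  rw [integral_pow_mul_pow, limitWordMoment, limitMoment, limitMoment]
  simp only [subword_append, List.count_append, SameCharge]
  obtain ⟨h11, h12⟩ := h1
  obtain ⟨h21, h22⟩ := h2
  by_cases h3 : (i.1 : ℕ) + b.1 = a.1 + j.1
  · by_cases h4 : (i.2 : ℕ) + b.2 = a.2 + j.2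
    · rw [if_pos (by omega), if_pos (by omega), if_pos ⟨h3, h4⟩]
    · have hn : ¬ (subword true v).count true + (subword true w).count true =
          (subword true v).count false + (subword true w).count false := by omega
      rw [if_neg hn]
      simp only [h4, and_false, if_false, Complex.ofReal_zero, mul_zero, zero_mul]
  · have hn : ¬ (subword false v).count true + (subword false w).count true =
        (subword false v).count false + (subword false w).count false := by omega
    rw [if_neg hn]
    simp only [h3, false_and, if_false, Complex.ofReal_zero, zero_mul]

lemma wordSum_limitWordMoment (α δ : ℝ) (ρ₀ : Matrix Qubits Qubits ℂ) (n m : ℕ) (i j : Qubits) :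
    wordSum (qubitLetter α δ) ρ₀ limitWordMoment n m i j =
      ∑ a, ∑ b, if SameCharge i a b j then ρ₀ a b *
        ∫ p : ℝ × ℝ, (classicalHamiltonian α δ p.1 p.2 ^ n) i a *
          (classicalHamiltonian α δ p.1 p.2 ^ m) b j ∂bathPairLaw else 0 := by
  have hint : ∀ a b, ∫ p : ℝ × ℝ, (classicalHamiltonian α δ p.1 p.2 ^ n) i a *
      (classicalHamiltonian α δ p.1 p.2 ^ m) b j ∂bathPairLaw =
      ∑ v : Fin n → Letter, ∑ w : Fin m → Letter,
        (∫ p : ℝ × ℝ, (p.1 : ℂ) ^ (subword false (List.ofFn v ++ List.ofFn w)).length *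
          (p.2 : ℂ) ^ (subword true (List.ofFn v ++ List.ofFn w)).length ∂bathPairLaw) *
        (((List.ofFn v).map (qubitLetter α δ)).prod i a *
          ((List.ofFn w).map (qubitLetter α δ)).prod b j) := by
    intro a b
    simp only [← integral_mul_const]
    have hi : ∀ (v : Fin n → Letter) (w : Fin m → Letter), Integrable (fun p : ℝ × ℝ =>
        (p.1 : ℂ) ^ (subword false (List.ofFn v ++ List.ofFn w)).length *
          (p.2 : ℂ) ^ (subword true (List.ofFn v ++ List.ofFn w)).length *
        (((List.ofFn v).map (qubitLetter α δ)).prod i a *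
          ((List.ofFn w).map (qubitLetter α δ)).prod b j)) bathPairLaw :=
      fun v w => (integrable_pow_mul_pow _ _).mul_const _
    have hs : ∀ v : Fin n → Letter, ∑ w : Fin m → Letter, ∫ p : ℝ × ℝ,
        (p.1 : ℂ) ^ (subword false (List.ofFn v ++ List.ofFn w)).length *
          (p.2 : ℂ) ^ (subword true (List.ofFn v ++ List.ofFn w)).length *
        (((List.ofFn v).map (qubitLetter α δ)).prod i a *
          ((List.ofFn w).map (qubitLetter α δ)).prod b j) ∂bathPairLaw =
        ∫ p : ℝ × ℝ, ∑ w : Fin m → Letter,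
        (p.1 : ℂ) ^ (subword false (List.ofFn v ++ List.ofFn w)).length *
          (p.2 : ℂ) ^ (subword true (List.ofFn v ++ List.ofFn w)).length *
        (((List.ofFn v).map (qubitLetter α δ)).prod i a *
          ((List.ofFn w).map (qubitLetter α δ)).prod b j) ∂bathPairLaw :=
      fun v => (integral_finsetSum _ fun w _ => hi v w).symm
    simp only [hs]
    rw [← integral_finsetSum _ fun v _ => integrable_finsetSum _ fun w _ => hi v w]
    refine integral_congr_ae (Eventually.of_forall fun p => ?_)
    simp only [classicalHamiltonian_pow, Matrix.sum_apply, Matrix.smul_apply, Finset.sum_mul_sum,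
      smul_eq_mul]
    refine Finset.sum_congr rfl fun v _ => Finset.sum_congr rfl fun w _ => ?_
    rw [subword_append, subword_append, List.length_append, List.length_append, pow_add, pow_add]
    ring
  have hexp : ∀ (v : Fin n → Letter) (w : Fin m → Letter),
      (limitWordMoment (List.ofFn v ++ List.ofFn w) • (((List.ofFn v).map (qubitLetter α δ)).prod *
        ρ₀ * ((List.ofFn w).map (qubitLetter α δ)).prod)) i j =
      ∑ a, ∑ b, ρ₀ a b * (limitWordMoment (List.ofFn v ++ List.ofFn w) *
        (((List.ofFn v).map (qubitLetter α δ)).prod i a *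
          ((List.ofFn w).map (qubitLetter α δ)).prod b j)) := by
    intro v w
    rw [Matrix.smul_apply, Matrix.mul_apply, Finset.sum_comm, smul_eq_mul, Finset.mul_sum]
    refine Finset.sum_congr rfl fun b _ => ?_
    rw [Matrix.mul_apply, Finset.sum_mul, Finset.mul_sum]
    refine Finset.sum_congr rfl fun a _ => ?_
    ring
  simp only [hint, wordSum, Matrix.sum_apply, hexp, limitWordMoment_mul]
  calc _ = ∑ v : Fin n → Letter, ∑ a, ∑ w : Fin m → Letter, ∑ b, _ :=
        Finset.sum_congr rfl fun v _ => Finset.sum_comm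
    _ = ∑ a, ∑ v : Fin n → Letter, ∑ w : Fin m → Letter, ∑ b, _ := Finset.sum_comm
    _ = ∑ a, ∑ v : Fin n → Letter, ∑ b, ∑ w : Fin m → Letter, _ :=
        Finset.sum_congr rfl fun a _ => Finset.sum_congr rfl fun v _ => Finset.sum_comm
    _ = ∑ a, ∑ b, ∑ v : Fin n → Letter, ∑ w : Fin m → Letter, _ :=
        Finset.sum_congr rfl fun a _ => Finset.sum_comm
    _ = _ := by
      refine Finset.sum_congr rfl fun a _ => Finset.sum_congr rfl fun b _ => ?_
      split_ifs
      · simp only [Finset.mul_sum]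
      · simp

lemma continuous_classicalHamiltonian (α δ : ℝ) :
    Continuous fun p : ℝ × ℝ => classicalHamiltonian α δ p.1 p.2 := by
  unfold classicalHamiltonian
  fun_prop

/-- Time evolution of the two qubits at given classical bath variables. -/
noncomputable def classicalEvolution (α δ t r s : ℝ) : Matrix Qubits Qubits ℂ :=
  NormedSpace.exp ((-(Complex.I * t)) • classicalHamiltonian α δ r s)

section OperatorNorm
open scoped Matrix.Norms.Operator

lemma exists_norm_classicalHamiltonian_le (α δ : ℝ) : ∃ A B : ℝ, 0 ≤ A ∧ 0 ≤ B ∧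
    ∀ r s, ‖classicalHamiltonian α δ r s‖ ≤ A + B * |r| + B * |s| := by
  set X := spinFlip ⊗ₖ (1 : Matrix (Fin 2) (Fin 2) ℂ)
  set Y := (1 : Matrix (Fin 2) (Fin 2) ℂ) ⊗ₖ spinFlip
  refine ⟨‖(4 * δ : ℂ) • (spinZ ⊗ₖ spinZ)‖, |α| * (‖X‖ + ‖Y‖), norm_nonneg _, by positivity,
    fun r s => ?_⟩
  have h1 : ‖(α * r : ℂ) • X‖ ≤ |α| * (‖X‖ + ‖Y‖) * |r| := by
    rw [norm_smul, norm_mul, Complex.norm_real, Complex.norm_real, Real.norm_eq_abs,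
      Real.norm_eq_abs]
    nlinarith [mul_nonneg (mul_nonneg (abs_nonneg α) (abs_nonneg r)) (norm_nonneg Y)]
  have h2 : ‖(α * s : ℂ) • Y‖ ≤ |α| * (‖X‖ + ‖Y‖) * |s| := by
    rw [norm_smul, norm_mul, Complex.norm_real, Complex.norm_real, Real.norm_eq_abs,
      Real.norm_eq_abs]
    nlinarith [mul_nonneg (mul_nonneg (abs_nonneg α) (abs_nonneg s)) (norm_nonneg X)]
  exact (norm_add_le _ _).trans (add_le_add ((norm_add_le _ _).trans (add_le_add le_rfl h1)) h2)

lemma norm_expCoeff (z : ℂ) (k : ℕ) : ‖expCoeff z k‖ = ‖z‖ ^ k / k.factorial := by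
  rw [expCoeff, norm_mul, norm_inv, norm_pow, Complex.norm_natCast]
  ring

lemma norm_pow_apply_le (X : Matrix Qubits Qubits ℂ) {Y : ℝ} (h : ‖X‖ ≤ Y) (n : ℕ)
    (i j : Qubits) : ‖(X ^ n) i j‖ ≤ Y ^ n :=
  (norm_entry_le _ i j).trans ((norm_pow_le X n).trans (by gcongr))

/-- Termwise integration of the double power series of the classical evolution. -/
lemma hasSum_integral_classical (α δ t : ℝ) (i a b j : Qubits) :
    HasSum (fun p : ℕ × ℕ => expCoeff (-(Complex.I * t)) p.1 * expCoeff (Complex.I * t) p.2 *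
      ∫ x : ℝ × ℝ, (classicalHamiltonian α δ x.1 x.2 ^ p.1) i a *
        (classicalHamiltonian α δ x.1 x.2 ^ p.2) b j ∂bathPairLaw)
      (∫ x : ℝ × ℝ, classicalEvolution α δ t x.1 x.2 i a *
        classicalEvolution α δ (-t) x.1 x.2 b j ∂bathPairLaw) := by
  obtain ⟨A, B, hA, hB, hAB⟩ := exists_norm_classicalHamiltonian_le α δ
  have hcont := continuous_classicalHamiltonian α δ
  let Y : ℝ × ℝ → ℝ := fun x => A + B * |x.1| + B * |x.2|
  have hY0 : ∀ x, 0 ≤ Y x := fun x => by positivity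
  have hexp : ∀ x, HasSum (fun p : ℕ × ℕ => (|t| * Y x) ^ p.1 / p.1.factorial *
      ((|t| * Y x) ^ p.2 / p.2.factorial)) (Real.exp (|t| * Y x) * Real.exp (|t| * Y x)) := by
    intro x
    have h1 := NormedSpace.expSeries_div_hasSum_exp (𝔸 := ℝ) (|t| * Y x)
    rw [← Real.exp_eq_exp_ℝ] at h1
    have h0 : ∀ n : ℕ, 0 ≤ (|t| * Y x) ^ n / n.factorial := fun n => by
      have := hY0 x
      positivity
    have h2 := Summable.mul_of_nonneg (f := fun n : ℕ => (|t| * Y x) ^ n / n.factorial)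
      (g := fun n : ℕ => (|t| * Y x) ^ n / n.factorial) h1.summable h1.summable h0 h0
    exact HasSum.mul (f := fun n : ℕ => (|t| * Y x) ^ n / n.factorial)
      (g := fun n : ℕ => (|t| * Y x) ^ n / n.factorial) h1 h1 h2
  simp only [← integral_const_mul]
  refine hasSum_integral_of_dominated_convergence
    (fun p x => (|t| * Y x) ^ p.1 / p.1.factorial * ((|t| * Y x) ^ p.2 / p.2.factorial))
    ?_ ?_ ?_ ?_ ?_
  · intro p
    refine Continuous.aestronglyMeasurable ?_
    exact ((((hcont.pow p.1).matrix_elem i a).mul ((hcont.pow p.2).matrix_elem b j)).const_mul _)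
  · refine fun p => Eventually.of_forall fun x => ?_
    have h1 := norm_pow_apply_le _ (hAB x.1 x.2) p.1 i a
    have h2 := norm_pow_apply_le _ (hAB x.1 x.2) p.2 b j
    have hz1 : ‖-(Complex.I * t)‖ = |t| := by simp
    have hz2 : ‖Complex.I * t‖ = |t| := by simp
    rw [norm_mul, norm_mul, norm_mul, norm_expCoeff, norm_expCoeff, hz1, hz2]
    have := hY0 x
    calc _ ≤ |t| ^ p.1 / p.1.factorial * (|t| ^ p.2 / p.2.factorial) * (Y x ^ p.1 * Y x ^ p.2) := by
          gcongr
      _ = _ := by rw [mul_pow, mul_pow]; ring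
  · exact Eventually.of_forall fun x => (hexp x).summable
  · have h1 : (fun x => ∑' p : ℕ × ℕ, (|t| * Y x) ^ p.1 / p.1.factorial *
        ((|t| * Y x) ^ p.2 / p.2.factorial)) = fun x : ℝ × ℝ => Real.exp (2 * |t| * A) *
          (Real.exp (2 * |t| * B * |x.1|) * Real.exp (2 * |t| * B * |x.2|)) := by
      ext x
      rw [(hexp x).tsum_eq, ← Real.exp_add, ← Real.exp_add, ← Real.exp_add]
      congr 1
      simp only [Y]
      ring
    rw [h1]
    exact (Integrable.mul_prod (integrable_exp_mul_abs_bathLaw _)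
      (integrable_exp_mul_abs_bathLaw _)).const_mul _
  · refine Eventually.of_forall fun x => ?_
    have h := hasSum_sandwich (-(Complex.I * t)) (Complex.I * t) (classicalHamiltonian α δ x.1 x.2)
      (Matrix.single a b 1)
    have h2 := Pi.hasSum.1 (Pi.hasSum.1 h i) j
    have hs : ∀ X Z : Matrix Qubits Qubits ℂ,
        (X * Matrix.single a b (1 : ℂ) * Z : Matrix Qubits Qubits ℂ) i j = X i a * Z b j := by
      intro X Z
      rw [Matrix.mul_apply, Finset.sum_eq_single b]
      · simp
      · intro c _ hc
        simp [hc]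
      · simp
    rw [hs] at h2
    simp only [Matrix.smul_apply, hs, smul_eq_mul] at h2
    rw [classicalEvolution, classicalEvolution]
    have : -(Complex.I * ((-t : ℝ) : ℂ)) = Complex.I * t := by push_cast; ring
    rw [this]
    exact h2

end OperatorNorm

/-- The thermodynamic limit of the reduced state, as an average over the classical bath variables
with a selection rule. -/
lemma tendsto_reducedState_apply_integral (α δ : ℝ) (ρ₀ : Matrix Qubits Qubits ℂ) (t : ℝ)
    (i j : Qubits) :
    Tendsto (fun N : ℕ => reducedState N α δ ρ₀ t i j) atTop
      (𝓝 (∑ a, ∑ b, if SameCharge i a b j then ρ₀ a b *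
        ∫ x : ℝ × ℝ, classicalEvolution α δ t x.1 x.2 i a *
          classicalEvolution α δ (-t) x.1 x.2 b j ∂bathPairLaw else 0)) := by
  have h := tendsto_reducedState_apply α δ ρ₀ t i j
  have h2 : HasSum (fun p : ℕ × ℕ => expCoeff (-(Complex.I * t)) p.1 *
      expCoeff (Complex.I * t) p.2 * wordSum (qubitLetter α δ) ρ₀ limitWordMoment p.1 p.2 i j)
      (∑ a, ∑ b, if SameCharge i a b j then ρ₀ a b *
        ∫ x : ℝ × ℝ, classicalEvolution α δ t x.1 x.2 i a *
          classicalEvolution α δ (-t) x.1 x.2 b j ∂bathPairLaw else 0) := by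
    simp only [wordSum_limitWordMoment, Finset.mul_sum]
    refine hasSum_sum fun a _ => hasSum_sum fun b _ => ?_
    split_ifs
    · have h3 := (hasSum_integral_classical α δ t i a b j).mul_left (ρ₀ a b)
      simpa only [mul_left_comm (ρ₀ a b)] using h3
    · simp only [mul_zero]
      exact hasSum_zero
  rwa [h2.tsum_eq] at h

/-! ### Closed form of the classical evolution -/

/-- Frequency of the two-level system with detuning `δ` and coupling `x`. -/
noncomputable def freq (δ x : ℝ) : ℝ := √(δ ^ 2 + x ^ 2)

/-- The function `sin(t ω) / ω` of the frequency `ω`, extended by `t` to `ω = 0`. -/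
noncomputable def sinOver (t ω : ℝ) : ℝ := t * Real.sinc (t * ω)

lemma mul_sinOver (t ω : ℝ) : ω * sinOver t ω = Real.sin (t * ω) := by
  unfold sinOver Real.sinc
  split_ifs with h
  · rw [h]; rcases mul_eq_zero.1 h with h0 | h0 <;> simp [h0]
  · have : t ≠ 0 := fun h0 => h (by simp [h0])
    have : ω ≠ 0 := fun h0 => h (by simp [h0])
    field_simp

/-- For `ε = ±1`, the projection onto the eigenspace `ε` of the conserved operator `σ_x ⊗ σ_x`. -/
noncomputable def parityProj (ε : ℝ) : Matrix Qubits Qubits ℂ :=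
  (2⁻¹ : ℂ) • (1 + (ε : ℂ) • (spinFlip ⊗ₖ spinFlip))

lemma parityProj_add : parityProj 1 + parityProj (-1) = 1 := by
  ext i j
  simp [parityProj]
  ring

/-- In each parity sector the classical Hamiltonian is a two-level Hamiltonian with detuning
`±δ`. -/
lemma classicalHamiltonian_sq_mul (α δ r s : ℝ) {ε : ℝ} (hε : ε = 1 ∨ ε = -1) :
    classicalHamiltonian α δ r s * (classicalHamiltonian α δ r s * parityProj ε) =
      ((freq δ (α * (r + ε * s)) : ℂ) ^ 2) • parityProj ε := by
  have hf : (freq δ (α * (r + ε * s)) : ℂ) ^ 2 = (δ ^ 2 + (α * (r + ε * s)) ^ 2 : ℂ) := by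
    rw [freq, ← Complex.ofReal_pow, Real.sq_sqrt (by positivity)]
    push_cast
    rfl
  rw [hf]
  ext ⟨i1, i2⟩ ⟨j1, j2⟩
  rcases hε with rfl | rfl <;>
  fin_cases i1 <;> fin_cases i2 <;> fin_cases j1 <;> fin_cases j2 <;>
    simp [classicalHamiltonian, parityProj, spinFlip, spinPlus, spinMinus, spinZ,
      Matrix.mul_apply, Fintype.sum_prod_type, Matrix.kroneckerMap_apply, Matrix.one_apply] <;>
    ring

/-- Powers of an element that acts as a square root of the scalar `ω ^ 2`. -/
lemma pow_mul_eq_of_sq {R : Type*} [Ring R] [Algebra ℂ R] {h p : R} {ω : ℂ}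
    (hsq : h * (h * p) = ω ^ 2 • p) (n : ℕ) :
    h ^ n * p = (if Even n then ω ^ n else 0) • p +
      (if Even n then 0 else ω ^ (n - 1)) • (h * p) := by
  induction n with
  | zero => simp
  | succ n ih =>
    rw [pow_succ', mul_assoc, ih, mul_add, mul_smul_comm, mul_smul_comm, hsq]
    rcases Nat.even_or_odd n with hn | hn
    · have h1 : ¬ Even (n + 1) := by simpa [Nat.even_add_one] using hn
      simp [hn, h1]
    · have h1 : Even (n + 1) := hn.add_one
      have h2 : ¬ Even n := Nat.not_even_iff_odd.2 hn
      obtain ⟨k, rfl⟩ := hn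
      simp only [h1, h2, if_true, if_false, zero_smul, zero_add, add_zero, smul_smul]
      rw [← pow_add]
      rfl

/-- Even part of the exponential series. -/
lemma hasSum_cos_freq (t ω : ℝ) :
    HasSum (fun n : ℕ => expCoeff (-(Complex.I * t)) n * if Even n then (ω : ℂ) ^ n else 0)
      (Real.cos (t * ω)) := by
  have h (z : ℂ) : HasSum (fun n : ℕ => z ^ n / n.factorial) (Complex.exp z) := by
    have := NormedSpace.expSeries_div_hasSum_exp (𝔸 := ℂ) z
    rwa [← Complex.exp_eq_exp_ℂ] at this
  have h3 := ((h (t * ω * Complex.I)).add (h (-(t * ω) * Complex.I))).div_const 2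
  rw [← Complex.cos] at h3
  rw [Complex.ofReal_cos]
  push_cast
  refine h3.congr_fun fun n => ?_
  have h1 : (-(t * ω) * Complex.I : ℂ) = -(t * ω * Complex.I) := by ring
  have h2 : (-(Complex.I * t)) = (-(t * Complex.I) : ℂ) := by ring
  rw [expCoeff, h1, h2]
  split_ifs with hn
  · rw [hn.neg_pow, hn.neg_pow]
    simp only [mul_pow]
    ring
  · rw [(Nat.not_even_iff_odd.1 hn).neg_pow (t * ω * Complex.I : ℂ)]
    ring

/-- Odd part of the exponential series, divided by the frequency. -/
lemma hasSum_sin_freq (t ω : ℝ) :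
    HasSum (fun n : ℕ => expCoeff (-(Complex.I * t)) n * if Even n then 0 else (ω : ℂ) ^ (n - 1))
      (-(Complex.I * sinOver t ω)) := by
  rcases eq_or_ne ω 0 with rfl | hω
  · have h0 : ∀ n : ℕ, n ≠ 1 →
        (expCoeff (-(Complex.I * t)) n * if Even n then 0 else ((0 : ℝ) : ℂ) ^ (n - 1)) = 0 := by
      intro n hn
      split_ifs with he
      · simp
      · have : n - 1 ≠ 0 := by
          rw [Nat.even_iff] at he
          omega
        simp [this]
    convert hasSum_single 1 h0 using 1
    simp [expCoeff, sinOver]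
  · have h (z : ℂ) : HasSum (fun n : ℕ => z ^ n / n.factorial) (Complex.exp z) := by
      have := NormedSpace.expSeries_div_hasSum_exp (𝔸 := ℂ) z
      rwa [← Complex.exp_eq_exp_ℂ] at this
    have hω' : (ω : ℂ) ≠ 0 := by exact_mod_cast hω
    have h3 := ((h (-(t * ω) * Complex.I)).sub (h (t * ω * Complex.I))).div_const (2 * ω : ℂ)
    have h4 : (Complex.exp (-(t * ω) * Complex.I) - Complex.exp (t * ω * Complex.I)) / (2 * ω) =
        -(Complex.I * sinOver t ω) := by
      have h5 : (ω : ℂ) * sinOver t ω = Complex.sin (t * ω) := by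
        rw [← Complex.ofReal_mul, mul_sinOver]
        push_cast
        rfl
      rw [Complex.sin] at h5
      rw [div_eq_iff (by simpa using hω)]
      linear_combination (2 * Complex.I) * h5 +
        (Complex.exp (-(t * ω) * Complex.I) - Complex.exp (t * ω * Complex.I)) * Complex.I_sq
    rw [h4] at h3
    refine h3.congr_fun fun n => ?_
    have h1 : (-(t * ω) * Complex.I : ℂ) = -(t * ω * Complex.I) := by ring
    have h2 : (-(Complex.I * t)) = (-(t * Complex.I) : ℂ) := by ring
    rw [expCoeff, h1, h2]
    split_ifs with hn
    · rw [hn.neg_pow, hn.neg_pow]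
      ring
    · have ho := Nat.not_even_iff_odd.1 hn
      rw [ho.neg_pow, ho.neg_pow]
      obtain ⟨k, rfl⟩ := ho
      simp only [mul_pow, Nat.add_sub_cancel]
      rw [pow_succ (ω : ℂ)]
      field_simp
      ring

lemma classicalEvolution_eq (α δ t r s : ℝ) :
    classicalEvolution α δ t r s =
      ((Real.cos (t * freq δ (α * (r + 1 * s))) : ℝ) : ℂ) • parityProj 1 +
      (-(Complex.I * sinOver t (freq δ (α * (r + 1 * s))))) •
        (classicalHamiltonian α δ r s * parityProj 1) +
      (((Real.cos (t * freq δ (α * (r + -1 * s))) : ℝ) : ℂ) • parityProj (-1) +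
      (-(Complex.I * sinOver t (freq δ (α * (r + -1 * s))))) •
        (classicalHamiltonian α δ r s * parityProj (-1))) := by
  have key : ∀ ε : ℝ, (ε = 1 ∨ ε = -1) → HasSum (fun n : ℕ => expCoeff (-(Complex.I * t)) n •
      (classicalHamiltonian α δ r s ^ n * parityProj ε))
      (((Real.cos (t * freq δ (α * (r + ε * s))) : ℝ) : ℂ) • parityProj ε +
      (-(Complex.I * sinOver t (freq δ (α * (r + ε * s))))) •
        (classicalHamiltonian α δ r s * parityProj ε)) := by
    intro ε hε
    have h1 := (hasSum_cos_freq t (freq δ (α * (r + ε * s)))).smul_const (parityProj ε)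
    have h2 := (hasSum_sin_freq t (freq δ (α * (r + ε * s)))).smul_const
      (classicalHamiltonian α δ r s * parityProj ε)
    refine (h1.add h2).congr_fun fun n => ?_
    rw [pow_mul_eq_of_sq (classicalHamiltonian_sq_mul α δ r s hε), smul_add, smul_smul, smul_smul]
  have h := (key 1 (Or.inl rfl)).add (key (-1) (Or.inr rfl))
  refine HasSum.unique ?_ h
  refine (hasSum_exp_smul_matrix (-(Complex.I * t)) (classicalHamiltonian α δ r s)).congr_fun
    fun n => ?_
  rw [← smul_add, ← mul_add, parityProj_add, mul_one]

/-- Amplitude of the state that a two-level system with detuning `δ` and coupling `x` starts in. -/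
noncomputable def stayAmp (δ t x : ℝ) : ℂ :=
  Real.cos (t * freq δ x) + Complex.I * (δ * sinOver t (freq δ x))

/-- Amplitude of the other state, up to the phase `-i`. -/
noncomputable def flipAmp (δ t x : ℝ) : ℝ := x * sinOver t (freq δ x)

/-- Matrix elements of the classical evolution out of and into `−+` and `+−`; the couplings `x` and
`y` belong to the sectors of parity `1` and `-1`. -/
lemma classicalEvolution_apply (α δ t r s : ℝ) :
    let U := classicalEvolution α δ t r s
    let x := α * (r + 1 * s)
    let y := α * (r + -1 * s)
    (U (0, 1) (0, 1) = (stayAmp δ t x + stayAmp δ t y) / 2 ∧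
      U (1, 0) (1, 0) = (stayAmp δ t x + stayAmp δ t y) / 2 ∧
      U (0, 1) (1, 0) = (stayAmp δ t x - stayAmp δ t y) / 2 ∧
      U (1, 0) (0, 1) = (stayAmp δ t x - stayAmp δ t y) / 2) ∧
    (U (0, 0) (0, 1) = -(Complex.I * (flipAmp δ t x - flipAmp δ t y) / 2) ∧
      U (0, 1) (0, 0) = -(Complex.I * (flipAmp δ t x - flipAmp δ t y) / 2) ∧
      U (1, 1) (1, 0) = -(Complex.I * (flipAmp δ t x - flipAmp δ t y) / 2) ∧
      U (1, 0) (1, 1) = -(Complex.I * (flipAmp δ t x - flipAmp δ t y) / 2)) ∧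
    (U (0, 0) (1, 0) = -(Complex.I * (flipAmp δ t x + flipAmp δ t y) / 2) ∧
      U (1, 0) (0, 0) = -(Complex.I * (flipAmp δ t x + flipAmp δ t y) / 2) ∧
      U (1, 1) (0, 1) = -(Complex.I * (flipAmp δ t x + flipAmp δ t y) / 2) ∧
      U (0, 1) (1, 1) = -(Complex.I * (flipAmp δ t x + flipAmp δ t y) / 2)) := by
  simp only [classicalEvolution_eq, stayAmp, flipAmp]
  generalize sinOver t (freq δ (α * (r + 1 * s))) = S₁
  generalize sinOver t (freq δ (α * (r + -1 * s))) = S₂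
  generalize Real.cos (t * freq δ (α * (r + 1 * s))) = C₁
  generalize Real.cos (t * freq δ (α * (r + -1 * s))) = C₂
  refine ⟨⟨?_, ?_, ?_, ?_⟩, ⟨?_, ?_, ?_, ?_⟩, ?_, ?_, ?_, ?_⟩ <;>
    simp [classicalHamiltonian, parityProj, spinFlip, spinPlus, spinMinus, spinZ,
      Matrix.mul_apply, Fintype.sum_prod_type, Matrix.kroneckerMap_apply, Matrix.one_apply] <;>
    ring

/-! ### The reduced state in the thermodynamic limit -/

/-- Matrix of X form in the ordered basis `−−, −+, +−, ++`: diagonal `a, b, b, a`, and `-c` in the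
two entries that couple `−+` and `+−`. -/
def xState (a b c : ℝ) : Matrix Qubits Qubits ℂ :=
  Matrix.of fun i j => if i = j then (if i.1 = i.2 then (a : ℂ) else b)
    else if i.1 ≠ i.2 ∧ j.1 ≠ j.2 then -(c : ℂ) else 0

lemma asymptoticState_eq (P : ℝ) :
    asymptoticState P = xState (P / 4) ((2 - P) / 4) ((2 - P) / 8) := by
  ext ⟨i1, i2⟩ ⟨j1, j2⟩
  fin_cases i1 <;> fin_cases i2 <;> fin_cases j1 <;> fin_cases j2 <;>
    simp [asymptoticState, xState, finProdFinEquiv]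

lemma sinOver_neg (t ω : ℝ) : sinOver (-t) ω = -sinOver t ω := by
  simp [sinOver]

lemma stayAmp_neg (δ t x : ℝ) : stayAmp δ (-t) x = starRingEnd ℂ (stayAmp δ t x) := by
  simp only [stayAmp, sinOver_neg, neg_mul, Real.cos_neg, map_add, map_mul, Complex.conj_ofReal,
    Complex.conj_I]
  push_cast
  ring

lemma flipAmp_neg (δ t x : ℝ) : flipAmp δ (-t) x = -flipAmp δ t x := by
  simp [flipAmp, sinOver_neg]

lemma freq_sq (δ x : ℝ) : freq δ x ^ 2 = δ ^ 2 + x ^ 2 := Real.sq_sqrt (by positivity)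

/-- Conservation of probability. -/
lemma normSq_stayAmp (δ t x : ℝ) : Complex.normSq (stayAmp δ t x) = 1 - flipAmp δ t x ^ 2 := by
  have h1 := mul_sinOver t (freq δ x)
  have h2 := Real.sin_sq_add_cos_sq (t * freq δ x)
  rw [← h1, mul_pow, freq_sq] at h2
  have h3 : Complex.normSq (stayAmp δ t x) =
      Real.cos (t * freq δ x) ^ 2 + (δ * sinOver t (freq δ x)) ^ 2 := by
    rw [Complex.normSq_apply]
    simp only [stayAmp]
    simp [-Complex.ofReal_cos]
    ring
  rw [h3, flipAmp]
  linarith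

/-- Factor `x² / (δ² + x²)` of the flip probability, which is `0` for `δ = x = 0`. -/
noncomputable def flipWeight (δ x : ℝ) : ℝ := x ^ 2 / (δ ^ 2 + x ^ 2)

lemma flipWeight_nonneg (δ x : ℝ) : 0 ≤ flipWeight δ x := by
  unfold flipWeight; positivity

lemma flipWeight_le_one (δ x : ℝ) : flipWeight δ x ≤ 1 :=
  div_le_one_of_le₀ (by nlinarith [sq_nonneg δ]) (by positivity)

lemma flipAmp_sq (δ t x : ℝ) :
    flipAmp δ t x ^ 2 = flipWeight δ x * Real.sin (t * freq δ x) ^ 2 := by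
  rw [flipAmp, flipWeight, ← mul_sinOver, mul_pow, mul_pow, freq_sq]
  rcases eq_or_ne (δ ^ 2 + x ^ 2) 0 with h | h
  · have : x ^ 2 = 0 := by nlinarith [sq_nonneg δ, sq_nonneg x]
    simp [this]
  · field_simp

lemma flipAmp_sq_le_one (δ t x : ℝ) : flipAmp δ t x ^ 2 ≤ 1 := by
  have := normSq_stayAmp δ t x
  have := Complex.normSq_nonneg (stayAmp δ t x)
  linarith

@[fun_prop] lemma continuous_freq (δ : ℝ) : Continuous (freq δ) := by
  unfold freq; fun_prop

@[fun_prop] lemma continuous_sinOver (t : ℝ) : Continuous (sinOver t) := by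
  unfold sinOver
  exact continuous_const.mul (Real.continuous_sinc.comp (by fun_prop))

@[fun_prop] lemma continuous_flipAmp (δ t : ℝ) : Continuous (flipAmp δ t) := by
  unfold flipAmp
  exact continuous_id.mul ((continuous_sinOver t).comp (continuous_freq δ))

@[fun_prop] lemma continuous_stayAmp (δ t : ℝ) : Continuous (stayAmp δ t) := by
  unfold stayAmp
  have h1 := continuous_freq δ
  have h2 := (continuous_sinOver t).comp h1
  simp only [Function.comp_def] at h2
  fun_prop

/-- Weight of `−−` and of `++` in the limiting state. The couplings of the two parity sectors are
written as `α (r + ε s)` with `ε = 1` and `ε = -1`. -/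
noncomputable def limitWeight (α δ t : ℝ) : ℝ :=
  ∫ p : ℝ × ℝ, (flipAmp δ t (α * (p.1 + 1 * p.2)) ^ 2 +
    flipAmp δ t (α * (p.1 + -1 * p.2)) ^ 2) / 4 ∂bathPairLaw

/-- Modulus of the coherence between `−+` and `+−` in the limiting state. -/
noncomputable def limitCoherence (α δ t : ℝ) : ℝ :=
  ∫ p : ℝ × ℝ, Complex.normSq (stayAmp δ t (α * (p.1 + 1 * p.2)) +
    stayAmp δ t (α * (p.1 + -1 * p.2))) / 8 ∂bathPairLaw

lemma singletState_apply (a b : Qubits) :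
    singletState a b =
      if a = (0, 1) then (if b = (0, 1) then 2⁻¹ else if b = (1, 0) then -2⁻¹ else 0)
      else if a = (1, 0) then (if b = (0, 1) then -2⁻¹ else if b = (1, 0) then 2⁻¹ else 0)
      else 0 := by
  have h : ((√2 : ℝ) : ℂ)⁻¹ * ((√2 : ℝ) : ℂ)⁻¹ = 2⁻¹ := by
    rw [← mul_inv, ← Complex.ofReal_mul, Real.mul_self_sqrt (by norm_num)]
    simp
  obtain ⟨a1, a2⟩ := a
  obtain ⟨b1, b2⟩ := b
  fin_cases a1 <;> fin_cases a2 <;> fin_cases b1 <;> fin_cases b2 <;>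
    simp [singletState, Matrix.vecMulVec_apply, singletVec, h]

lemma integrable_bathPairLaw_of_continuous {E : Type*} [NormedAddCommGroup E] {g : ℝ × ℝ → E}
    (hg : Continuous g) [SecondCountableTopologyEither (ℝ × ℝ) E] (C : ℝ) (hC : ∀ p, ‖g p‖ ≤ C) :
    Integrable g bathPairLaw :=
  Integrable.of_bound hg.aestronglyMeasurable C (Eventually.of_forall hC)

lemma norm_stayAmp_le_one (δ t x : ℝ) : ‖stayAmp δ t x‖ ≤ 1 := by
  rw [← sq_le_one_iff₀ (norm_nonneg _), ← Complex.normSq_eq_norm_sq, normSq_stayAmp]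
  nlinarith [sq_nonneg (flipAmp δ t x)]

lemma abs_flipAmp_le_one (δ t x : ℝ) : |flipAmp δ t x| ≤ 1 :=
  (sq_le_one_iff_abs_le_one _).1 (flipAmp_sq_le_one δ t x)

/-- Weight of `−+` and of `+−` in the limiting state: each comes with probability `1/2` from each of
the two components of the singlet. -/
lemma integral_stay (α δ t : ℝ) :
    (2⁻¹ : ℂ) * (∫ p : ℝ × ℝ,
      (stayAmp δ t (α * (p.1 + 1 * p.2)) + stayAmp δ t (α * (p.1 + -1 * p.2))) / 2 *
      ((starRingEnd ℂ (stayAmp δ t (α * (p.1 + 1 * p.2))) +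
        starRingEnd ℂ (stayAmp δ t (α * (p.1 + -1 * p.2)))) / 2) ∂bathPairLaw) +
    2⁻¹ * (∫ p : ℝ × ℝ,
      (stayAmp δ t (α * (p.1 + 1 * p.2)) - stayAmp δ t (α * (p.1 + -1 * p.2))) / 2 *
      ((starRingEnd ℂ (stayAmp δ t (α * (p.1 + 1 * p.2))) -
        starRingEnd ℂ (stayAmp δ t (α * (p.1 + -1 * p.2)))) / 2) ∂bathPairLaw) =
    ((1 / 2 - limitWeight α δ t : ℝ) : ℂ) := by
  have hcs : Continuous fun p : ℝ × ℝ => stayAmp δ t (α * (p.1 + 1 * p.2)) :=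
    (continuous_stayAmp δ t).comp (by fun_prop)
  have hcs' : Continuous fun p : ℝ × ℝ => stayAmp δ t (α * (p.1 + -1 * p.2)) :=
    (continuous_stayAmp δ t).comp (by fun_prop)
  have hpop : ∀ {g : ℝ × ℝ → ℂ}, Continuous g → (∀ p, ‖g p‖ ≤ 1) → Integrable g bathPairLaw :=
    fun hg h => integrable_bathPairLaw_of_continuous hg 1 h
  rw [← mul_add, ← integral_add, limitWeight]
  · have h1 : Integrable (fun p : ℝ × ℝ => (flipAmp δ t (α * (p.1 + 1 * p.2)) ^ 2 +
        flipAmp δ t (α * (p.1 + -1 * p.2)) ^ 2) / 4) bathPairLaw := by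
      refine integrable_bathPairLaw_of_continuous (by fun_prop) 1 fun p => ?_
      have e1 := flipAmp_sq_le_one δ t (α * (p.1 + 1 * p.2))
      have e2 := flipAmp_sq_le_one δ t (α * (p.1 + -1 * p.2))
      rw [Real.norm_of_nonneg (by positivity)]
      linarith
    have h2 : (1 / 2 : ℝ) = ∫ _ : ℝ × ℝ, (1 / 2 : ℝ) ∂bathPairLaw := by simp
    rw [h2, ← integral_sub (integrable_const _) h1, ← integral_complex_ofReal,
      ← integral_const_mul]
    refine integral_congr_ae (Eventually.of_forall fun p => ?_)
    have e1 := normSq_stayAmp δ t (α * (p.1 + 1 * p.2))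
    have e2 := normSq_stayAmp δ t (α * (p.1 + -1 * p.2))
    have e1' := Complex.mul_conj (stayAmp δ t (α * (p.1 + 1 * p.2)))
    have e2' := Complex.mul_conj (stayAmp δ t (α * (p.1 + -1 * p.2)))
    rw [e1] at e1'
    rw [e2] at e2'
    push_cast at e1' e2' ⊢
    linear_combination (1 / 4 : ℂ) * e1' + (1 / 4 : ℂ) * e2'
  · refine hpop (by fun_prop) fun p => ?_
    have e1 := norm_stayAmp_le_one δ t (α * (p.1 + 1 * p.2))
    have e2 := norm_stayAmp_le_one δ t (α * (p.1 + -1 * p.2))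
    rw [← map_add, norm_mul, norm_div, norm_div, Complex.norm_conj, Complex.norm_two]
    have := norm_add_le (stayAmp δ t (α * (p.1 + 1 * p.2))) (stayAmp δ t (α * (p.1 + -1 * p.2)))
    exact mul_le_one₀ (by linarith) (by positivity) (by linarith)
  · refine hpop (by fun_prop) fun p => ?_
    have e1 := norm_stayAmp_le_one δ t (α * (p.1 + 1 * p.2))
    have e2 := norm_stayAmp_le_one δ t (α * (p.1 + -1 * p.2))
    rw [← map_sub, norm_mul, norm_div, norm_div, Complex.norm_conj, Complex.norm_two]
    have := norm_sub_le (stayAmp δ t (α * (p.1 + 1 * p.2))) (stayAmp δ t (α * (p.1 + -1 * p.2)))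
    exact mul_le_one₀ (by linarith) (by positivity) (by linarith)

/-- Weight of `−−` and of `++`, collected from the two components of the singlet. -/
lemma integral_flip (α δ t : ℝ) :
    (2⁻¹ : ℂ) * (∫ p : ℝ × ℝ,
      (Complex.I * (flipAmp δ t (α * (p.1 + 1 * p.2)) - flipAmp δ t (α * (p.1 + -1 * p.2))) / 2) *
      (Complex.I * (-flipAmp δ t (α * (p.1 + 1 * p.2)) - -flipAmp δ t (α * (p.1 + -1 * p.2))) / 2)
        ∂bathPairLaw) +
    2⁻¹ * (∫ p : ℝ × ℝ,
      (Complex.I * (flipAmp δ t (α * (p.1 + 1 * p.2)) + flipAmp δ t (α * (p.1 + -1 * p.2))) / 2) *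
      (Complex.I * (-flipAmp δ t (α * (p.1 + 1 * p.2)) + -flipAmp δ t (α * (p.1 + -1 * p.2))) / 2)
        ∂bathPairLaw) =
    ((limitWeight α δ t : ℝ) : ℂ) := by
  have hcf : Continuous fun p : ℝ × ℝ => flipAmp δ t (α * (p.1 + 1 * p.2)) :=
    (continuous_flipAmp δ t).comp (by fun_prop)
  have hcf' : Continuous fun p : ℝ × ℝ => flipAmp δ t (α * (p.1 + -1 * p.2)) :=
    (continuous_flipAmp δ t).comp (by fun_prop)
  have hpop : ∀ {g : ℝ × ℝ → ℂ}, Continuous g → (∀ p, ‖g p‖ ≤ 1) → Integrable g bathPairLaw :=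
    fun hg h => integrable_bathPairLaw_of_continuous hg 1 h
  rw [← mul_add, ← integral_add, limitWeight]
  · rw [← integral_complex_ofReal, ← integral_const_mul]
    refine integral_congr_ae (Eventually.of_forall fun p => ?_)
    push_cast
    linear_combination (-(((flipAmp δ t (α * (p.1 + 1 * p.2)) : ℂ) ^ 2 +
      (flipAmp δ t (α * (p.1 + -1 * p.2)) : ℂ) ^ 2) / 4)) * Complex.I_sq
  · refine hpop (by fun_prop) fun p => ?_
    have e1 := abs_flipAmp_le_one δ t (α * (p.1 + 1 * p.2))
    have e2 := abs_flipAmp_le_one δ t (α * (p.1 + -1 * p.2))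
    rw [neg_sub_neg, ← Complex.ofReal_sub, ← Complex.ofReal_sub]
    simp only [norm_mul, norm_div, Complex.norm_I, Complex.norm_real, Complex.norm_two,
      Real.norm_eq_abs]
    have h1 := abs_sub (flipAmp δ t (α * (p.1 + 1 * p.2))) (flipAmp δ t (α * (p.1 + -1 * p.2)))
    have h2 := abs_sub (flipAmp δ t (α * (p.1 + -1 * p.2))) (flipAmp δ t (α * (p.1 + 1 * p.2)))
    exact mul_le_one₀ (by linarith) (by positivity) (by linarith)
  · refine hpop (by fun_prop) fun p => ?_
    have e1 := abs_flipAmp_le_one δ t (α * (p.1 + 1 * p.2))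
    have e2 := abs_flipAmp_le_one δ t (α * (p.1 + -1 * p.2))
    rw [← neg_add, ← Complex.ofReal_add]
    simp only [norm_mul, norm_div, norm_neg, Complex.norm_I, Complex.norm_real, Complex.norm_two,
      Real.norm_eq_abs]
    have h1 := abs_add_le (flipAmp δ t (α * (p.1 + 1 * p.2)))
      (flipAmp δ t (α * (p.1 + -1 * p.2)))
    exact mul_le_one₀ (by linarith) (by positivity) (by linarith)

lemma integral_coherence (α δ t : ℝ) :
    (2⁻¹ : ℂ) * (∫ p : ℝ × ℝ,
      (stayAmp δ t (α * (p.1 + 1 * p.2)) + stayAmp δ t (α * (p.1 + -1 * p.2))) / 2 *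
      ((starRingEnd ℂ (stayAmp δ t (α * (p.1 + 1 * p.2))) +
        starRingEnd ℂ (stayAmp δ t (α * (p.1 + -1 * p.2)))) / 2) ∂bathPairLaw) =
    ((limitCoherence α δ t : ℝ) : ℂ) := by
  rw [limitCoherence, ← integral_complex_ofReal, ← integral_const_mul]
  refine integral_congr_ae (Eventually.of_forall fun p => ?_)
  have e := Complex.mul_conj (stayAmp δ t (α * (p.1 + 1 * p.2)) +
    stayAmp δ t (α * (p.1 + -1 * p.2)))
  rw [map_add] at e
  push_cast
  rw [← e]
  ring

/-- The selection rule removes the interference of the two components of the singlet from the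
populations, and all coherences other than the one between `−+` and `+−`. -/
lemma tendsto_reducedState_singlet (α δ t : ℝ) :
    Tendsto (fun N : ℕ => reducedState N α δ singletState t) atTop
      (𝓝 (xState (limitWeight α δ t) (1 / 2 - limitWeight α δ t) (limitCoherence α δ t))) := by
  refine tendsto_pi_nhds.2 fun i => tendsto_pi_nhds.2 fun j => ?_
  convert tendsto_reducedState_apply_integral α δ singletState t i j using 2
  have hU := fun p : ℝ × ℝ => classicalEvolution_apply α δ t p.1 p.2
  have hU' := fun p : ℝ × ℝ => classicalEvolution_apply α δ (-t) p.1 p.2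
  simp only [stayAmp_neg, flipAmp_neg] at hU hU'
  have u1 := fun p => (hU p).1.1
  have u2 := fun p => (hU p).1.2.1
  have u3 := fun p => (hU p).1.2.2.1
  have u4 := fun p => (hU p).1.2.2.2
  have u5 := fun p => (hU p).2.1.1
  have u6 := fun p => (hU p).2.1.2.2.1
  have u7 := fun p => (hU p).2.2.1
  have u8 := fun p => (hU p).2.2.2.2.1
  have v1 := fun p => (hU' p).1.1
  have v2 := fun p => (hU' p).1.2.1
  have v3 := fun p => (hU' p).1.2.2.1
  have v4 := fun p => (hU' p).1.2.2.2
  have v5 := fun p => (hU' p).2.1.2.1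
  have v6 := fun p => (hU' p).2.1.2.2.2
  have v7 := fun p => (hU' p).2.2.2.1
  have v8 := fun p => (hU' p).2.2.2.2.2
  have hstay := integral_stay α δ t
  have hflip := integral_flip α δ t
  have hcoh := integral_coherence α δ t
  obtain ⟨i1, i2⟩ := i
  obtain ⟨j1, j2⟩ := j
  fin_cases i1 <;> fin_cases i2 <;> fin_cases j1 <;> fin_cases j2 <;>
    simp [xState, SameCharge, singletState_apply, Fintype.sum_prod_type, -one_div,
      -Complex.ofReal_sub, -one_mul, -neg_mul, -mul_neg, -sub_neg_eq_add,
      u1, u2, u3, u4, u5, u6, u7, u8, v1, v2, v3, v4, v5, v6, v7, v8]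
  · simpa only [neg_mul_neg] using hflip.symm
  · exact hstay.symm
  · rw [neg_mul, hcoh]
  · rw [neg_mul, hcoh]
  · exact (hstay.symm.trans (add_comm _ _))
  · have := hflip.symm.trans (add_comm _ _)
    simpa only [neg_mul_neg] using this

/-! ### Riemann–Lebesgue lemma for the dispersion `√(δ² + α² y²)` -/

/-- Riemann–Lebesgue on the half-line with a phase of positive derivative: the phase is taken as
new variable of integration. -/
lemma tendsto_integral_Ioi_exp_phase {φ φ' : ℝ → ℝ} (hφ : ∀ x ∈ Ioi (0 : ℝ), HasDerivAt φ (φ' x) x)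
    (hpos : ∀ x ∈ Ioi (0 : ℝ), 0 < φ' x) (g : ℝ → ℂ) :
    Tendsto (fun t : ℝ => ∫ x in Ioi (0 : ℝ), Complex.exp (Complex.I * (t * φ x : ℝ)) * g x)
      atTop (𝓝 0) := by
  have hmono : StrictMonoOn φ (Ioi 0) := by
    refine strictMonoOn_of_deriv_pos (convex_Ioi 0)
      (fun x hx => (hφ x hx).continuousAt.continuousWithinAt) fun x hx => ?_
    rw [interior_Ioi] at hx
    rw [(hφ x hx).deriv]
    exact hpos x hx
  have hinj := hmono.injOn
  have hmeas : MeasurableSet (φ '' Ioi 0) := measurableSet_Ioi.image_of_continuousOn_injOn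
    (fun x hx => (hφ x hx).continuousAt.continuousWithinAt) hinj
  let ψ := Function.invFunOn φ (Ioi 0)
  have hψ : ∀ x ∈ Ioi (0 : ℝ), ψ (φ x) = x := fun x hx => hinj.leftInvOn_invFunOn hx
  let G : ℝ → ℂ := (φ '' Ioi 0).indicator fun v => (φ' (ψ v) : ℂ)⁻¹ * g (ψ v)
  have h := Real.tendsto_integral_exp_smul_cocompact G
  have hw : Tendsto (fun t : ℝ => -(t / (2 * Real.pi))) atTop (cocompact ℝ) :=
    (tendsto_neg_atTop_atBot.comp (tendsto_id.atTop_div_const (by positivity))).mono_right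
      atBot_le_cocompact
  refine (h.comp hw).congr fun t => ?_
  simp only [Function.comp]
  have h1 : ∀ v, Real.fourierChar (-(v * -(t / (2 * Real.pi)))) • G v =
      (φ '' Ioi 0).indicator (fun v => Complex.exp (Complex.I * (t * v : ℝ)) *
        ((φ' (ψ v) : ℂ)⁻¹ * g (ψ v))) v := by
    intro v
    by_cases hv : v ∈ φ '' Ioi 0
    · simp only [G, indicator_of_mem hv]
      rw [Circle.smul_def, Real.fourierChar_apply, smul_eq_mul]
      congr 2
      push_cast
      have : (Real.pi : ℂ) ≠ 0 := by exact_mod_cast Real.pi_ne_zero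
      field_simp
    · simp only [G, indicator_of_notMem hv, smul_zero]
  simp only [h1]
  rw [integral_indicator hmeas, integral_image_eq_integral_abs_deriv_smul measurableSet_Ioi
    (fun x hx => (hφ x hx).hasDerivWithinAt) hinj]
  refine setIntegral_congr_fun measurableSet_Ioi fun x hx => ?_
  have h2 := hpos x hx
  have h3 : (φ' x : ℂ) ≠ 0 := by exact_mod_cast h2.ne'
  simp only [hψ x hx, abs_of_pos h2, Complex.real_smul]
  field_simp

lemma freq_neg (δ x : ℝ) : freq δ (-x) = freq δ x := by
  simp [freq]

lemma tendsto_integral_exp_freq {α : ℝ} (hα : α ≠ 0) (δ c : ℝ) {g : ℝ → ℂ} (hg : Integrable g) :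
    Tendsto (fun t : ℝ => ∫ y, Complex.exp (Complex.I * (t * freq δ (α * (y + c)) : ℝ)) * g y)
      atTop (𝓝 0) := by
  have hder : ∀ x ∈ Ioi (0 : ℝ), HasDerivAt (fun x => freq δ (α * x))
      (α ^ 2 * x / freq δ (α * x)) x := by
    intro x hx
    have hx' : 0 < x := hx
    have hp : 0 < δ ^ 2 + (α * x) ^ 2 := by positivity
    have h1 : HasDerivAt (fun x => δ ^ 2 + (α * x) ^ 2) (2 * (α * x) * α) x := by
      have := (((hasDerivAt_id x).const_mul α).pow 2).const_add (δ ^ 2)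
      simpa using this
    have h2 := h1.sqrt hp.ne'
    refine h2.congr_deriv ?_
    rw [freq]
    have := (Real.sqrt_pos.2 hp).ne'
    field_simp
  have hpos : ∀ x ∈ Ioi (0 : ℝ), 0 < α ^ 2 * x / freq δ (α * x) := by
    intro x hx
    have hx' : 0 < x := hx
    have : 0 < freq δ (α * x) := Real.sqrt_pos.2 (by positivity)
    positivity
  have h1 := tendsto_integral_Ioi_exp_phase hder hpos fun y => g (y - c)
  have h2 := tendsto_integral_Ioi_exp_phase hder hpos fun y => g (-y - c)
  have h3 := h1.add h2
  rw [add_zero] at h3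
  refine h3.congr fun t => ?_
  set F : ℝ → ℂ := fun y => Complex.exp (Complex.I * (t * freq δ (α * y) : ℝ)) * g (y - c) with hF
  have hFi : Integrable F := by
    refine (hg.comp_sub_right c).bdd_mul (c := 1) (Continuous.aestronglyMeasurable ?_)
      (Eventually.of_forall fun y => ?_)
    · have := continuous_freq δ
      fun_prop
    · rw [mul_comm, Complex.norm_exp_ofReal_mul_I]
  have h4 : ∫ y, Complex.exp (Complex.I * (t * freq δ (α * (y + c)) : ℝ)) * g y = ∫ y, F y := by
    rw [← integral_add_right_eq_self F c]
    simp [hF]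
  have h5 : ∫ y in Ioi (0 : ℝ), Complex.exp (Complex.I * (t * freq δ (α * y) : ℝ)) * g (-y - c) =
      ∫ y in Iic (0 : ℝ), F y := by
    have := integral_comp_neg_Ioi 0 F
    rw [neg_zero] at this
    rw [← this]
    simp only [hF, mul_neg, freq_neg]
  rw [h4, h5, add_comm, ← intervalIntegral.integral_Iic_add_Ioi hFi.integrableOn hFi.integrableOn]

lemma tendsto_integral_cos_freq {α : ℝ} (hα : α ≠ 0) (δ c : ℝ) {g : ℝ → ℝ} (hg : Integrable g) :
    Tendsto (fun t : ℝ => ∫ y, Real.cos (t * freq δ (α * (y + c))) * g y) atTop (𝓝 0) ∧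
    Tendsto (fun t : ℝ => ∫ y, Real.sin (t * freq δ (α * (y + c))) * g y) atTop (𝓝 0) := by
  have h := tendsto_integral_exp_freq hα δ c (hg.ofReal (𝕜 := ℂ))
  have hi : ∀ t : ℝ, Integrable fun y =>
      Complex.exp (Complex.I * (t * freq δ (α * (y + c)) : ℝ)) * (g y : ℂ) := by
    intro t
    refine (hg.ofReal (𝕜 := ℂ)).bdd_mul (c := 1) (Continuous.aestronglyMeasurable ?_)
      (Eventually.of_forall fun y => ?_)
    · have := continuous_freq δ
      fun_prop
    · rw [mul_comm, Complex.norm_exp_ofReal_mul_I]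
  constructor
  · have h1 := (Complex.continuous_re.tendsto _).comp h
    simp only [Complex.zero_re] at h1
    refine h1.congr fun t => ?_
    simp only [Function.comp]
    have := integral_re (hi t)
    simp only [RCLike.re_eq_complex_re] at this
    refine Eq.trans this.symm (integral_congr_ae (Eventually.of_forall fun y => ?_))
    simp only
    rw [Complex.re_mul_ofReal, mul_comm Complex.I, Complex.exp_ofReal_mul_I_re]
  · have h1 := (Complex.continuous_im.tendsto _).comp h
    simp only [Complex.zero_im] at h1
    refine h1.congr fun t => ?_
    simp only [Function.comp]
    have := integral_im (hi t)
    simp only [RCLike.im_eq_complex_im] at this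
    refine Eq.trans this.symm (integral_congr_ae (Eventually.of_forall fun y => ?_))
    simp only
    rw [Complex.im_mul_ofReal, mul_comm Complex.I, Complex.exp_ofReal_mul_I_im]

/-! ### Sum and difference of the bath variables -/

/-- The density of the bath variable, extended by zero to the real line. -/
noncomputable def extDensity : ℝ → ℝ := (Ioi (0 : ℝ)).indicator bathDensity

lemma integrable_extDensity : Integrable extDensity :=
  (integrable_indicator_iff measurableSet_Ioi).2 integrableOn_bathDensity

lemma extDensity_nonneg (r : ℝ) : 0 ≤ extDensity r :=
  indicator_nonneg (fun _ hr => bathDensity_nonneg (le_of_lt hr)) r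

lemma integral_bathLaw_eq_extDensity (g : ℝ → ℝ) :
    ∫ r, g r ∂bathLaw = ∫ r, extDensity r * g r := by
  rw [integral_bathLaw, ← integral_indicator measurableSet_Ioi]
  congr 1
  ext r
  by_cases hr : r ∈ Ioi (0 : ℝ) <;> simp [extDensity, hr]

lemma integrable_shear {f₁ f₂ : ℝ → ℝ} (h₁ : Integrable f₁) (h₂ : Integrable f₂) {k : ℝ × ℝ → ℝ}
    (hk : Measurable k) {C : ℝ} (hC : ∀ p, |k p| ≤ C) :
    Integrable (fun p : ℝ × ℝ => f₁ p.2 * f₂ (p.1 - p.2) * k p) (volume.prod volume) := by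
  have h := h₁.convolution_integrand (ContinuousLinearMap.mul ℝ ℝ) h₂
  simp only [ContinuousLinearMap.mul_apply'] at h
  exact h.mul_bdd (c := C) hk.aestronglyMeasurable (Eventually.of_forall hC)

/-- Change of variables `(r, s) ↦ (μ, r) = (r + s, r)`. -/
lemma integral_shear {f₁ f₂ : ℝ → ℝ} (h₁ : Integrable f₁) (h₂ : Integrable f₂) {k : ℝ × ℝ → ℝ}
    (hk : Measurable k) {C : ℝ} (hC : ∀ p, |k p| ≤ C) :
    ∫ r, ∫ s, f₁ r * f₂ s * k (r + s, r) = ∫ μ, ∫ r, f₁ r * f₂ (μ - r) * k (μ, r) := by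
  rw [integral_integral_swap (f := fun μ r => f₁ r * f₂ (μ - r) * k (μ, r))
    (integrable_shear h₁ h₂ hk hC)]
  congr 1
  ext r
  rw [← integral_sub_right_eq_self (fun s => f₁ r * f₂ s * k (r + s, r)) r]
  simp

lemma integral_bathPairLaw {g : ℝ × ℝ → ℝ} (hg : Integrable g bathPairLaw) :
    ∫ p, g p ∂bathPairLaw = ∫ r, ∫ s, extDensity r * extDensity s * g (r, s) := by
  rw [integral_prod _ hg, integral_bathLaw_eq_extDensity]
  congr 1
  ext r
  rw [integral_bathLaw_eq_extDensity, ← integral_const_mul]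
  congr 1
  ext s
  ring

lemma integrable_bathPairLaw_of_bounded {g : ℝ × ℝ → ℝ} (hg : Measurable g) {C : ℝ}
    (hC : ∀ p, |g p| ≤ C) : Integrable g bathPairLaw :=
  Integrable.of_bound hg.aestronglyMeasurable C (Eventually.of_forall hC)

lemma densityQ_eq {μ : ℝ} (hμ : 0 < μ) :
    densityQ μ = ∫ r, extDensity r * extDensity (μ - r) := by
  rw [densityQ, intervalIntegral.integral_of_le hμ.le, integral_Ioc_eq_integral_Ioo,
    ← integral_indicator measurableSet_Ioo]
  congr 1
  ext r
  by_cases h1 : 0 < r <;> by_cases h2 : r < μ <;>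
    simp [extDensity, indicator, h1, h2, mul_comm]

lemma extDensity_convolution_eq_zero {μ : ℝ} (hμ : μ ≤ 0) :
    ∫ r, extDensity r * extDensity (μ - r) = 0 := by
  refine integral_eq_zero_of_ae (Eventually.of_forall fun r => ?_)
  by_cases h1 : 0 < r
  · have h2 : ¬ r < μ := by linarith
    simp [extDensity, indicator, h2]
  · simp [extDensity, indicator, h1]

lemma densityR_eq (η : ℝ) :
    densityR η = ∫ r, extDensity r * extDensity (r - η) := by
  rw [densityR, ← integral_indicator measurableSet_Ioi,
    ← integral_add_right_eq_self (fun r => extDensity r * extDensity (r - η)) η]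
  congr 1
  ext s
  have h3 : -η < s ↔ 0 < s + η := ⟨fun h => by linarith, fun h => by linarith⟩
  by_cases h1 : 0 < s <;> by_cases h2 : 0 < s + η <;>
    simp [extDensity, indicator, h1, h2, h3, add_comm η]

/-- `densityQ` is the density of the sum of two independent bath variables. -/
lemma integral_densityQ_mul {k : ℝ → ℝ} (hk : Measurable k) {C : ℝ} (hC : ∀ x, |k x| ≤ C) :
    ∫ μ in Ioi (0 : ℝ), densityQ μ * k μ = ∫ p : ℝ × ℝ, k (p.1 + 1 * p.2) ∂bathPairLaw := by
  rw [integral_bathPairLaw (integrable_bathPairLaw_of_bounded (by fun_prop) fun p => hC _)]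
  have h := integral_shear integrable_extDensity integrable_extDensity (k := fun p => k p.1)
    (hk.comp measurable_fst) fun p => hC p.1
  simp only [one_mul]
  rw [h]
  simp only [integral_mul_const]
  have h0 := setIntegral_eq_integral_of_forall_compl_eq_zero (μ := volume) (s := Ioi (0 : ℝ))
    (f := fun μ => (∫ r, extDensity r * extDensity (μ - r)) * k μ) fun μ hμ => by
      rw [extDensity_convolution_eq_zero (not_lt.1 hμ), zero_mul]
  rw [← h0]
  refine setIntegral_congr_fun measurableSet_Ioi fun μ hμ => ?_
  simp only [densityQ_eq hμ]

/-- `densityR` is the density of the difference of two independent bath variables. -/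
lemma integral_densityR_mul {k : ℝ → ℝ} (hk : Measurable k) {C : ℝ} (hC : ∀ x, |k x| ≤ C) :
    ∫ η, densityR η * k η = ∫ p : ℝ × ℝ, k (p.1 + -1 * p.2) ∂bathPairLaw := by
  rw [integral_bathPairLaw (integrable_bathPairLaw_of_bounded (by fun_prop) fun p => hC _)]
  have h := integral_shear integrable_extDensity (f₂ := fun s => extDensity (-s))
    integrable_extDensity.comp_neg (k := fun p => k p.1) (hk.comp measurable_fst) fun p => hC p.1
  simp only [neg_sub, integral_mul_const, ← densityR_eq] at h
  rw [← h]
  congr 1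
  ext r
  rw [← integral_neg_eq_self]
  simp

/-! ### Long-time limits -/

@[fun_prop] lemma measurable_flipWeight (δ : ℝ) : Measurable (flipWeight δ) := by
  unfold flipWeight; fun_prop

lemma abs_flipWeight_le_one (δ x : ℝ) : |flipWeight δ x| ≤ 1 := by
  rw [abs_of_nonneg (flipWeight_nonneg δ x)]
  exact flipWeight_le_one δ x

lemma integrable_flipAmp_sq (ε α δ t : ℝ) :
    Integrable (fun p : ℝ × ℝ => flipAmp δ t (α * (p.1 + ε * p.2)) ^ 2) bathPairLaw := by
  refine integrable_bathPairLaw_of_bounded (C := 1) ?_ fun p => ?_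
  · have := continuous_flipAmp δ t
    exact Continuous.measurable (by fun_prop)
  · rw [abs_of_nonneg (sq_nonneg _)]
    exact flipAmp_sq_le_one _ _ _

lemma integrable_flipWeight (ε α δ : ℝ) :
    Integrable (fun p : ℝ × ℝ => flipWeight δ (α * (p.1 + ε * p.2))) bathPairLaw :=
  integrable_bathPairLaw_of_bounded (C := 1) ((measurable_flipWeight δ).comp (by fun_prop))
    fun _ => abs_flipWeight_le_one _ _

/-- `Λ±(t)` is the mean flip probability in the sector of parity `±1`. -/
lemma lambdaIntegral_eq (ε α δ t : ℝ) :
    lambdaIntegral ε α δ t =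
      ∫ p : ℝ × ℝ, flipAmp δ t (α * (p.1 + ε * p.2)) ^ 2 ∂bathPairLaw := by
  rw [integral_prod _ (integrable_flipAmp_sq ε α δ t), integral_bathLaw, lambdaIntegral]
  refine setIntegral_congr_fun measurableSet_Ioi fun r _ => ?_
  simp only
  rw [integral_bathLaw, smul_eq_mul, ← integral_const_mul]
  refine setIntegral_congr_fun measurableSet_Ioi fun s _ => ?_
  simp only [smul_eq_mul, flipAmp_sq, flipWeight, freq, mul_pow]
  ring

lemma lambdaPlusInf_eq (α δ : ℝ) :
    lambdaPlusInf α δ = 1 / 2 * ∫ p : ℝ × ℝ, flipWeight δ (α * (p.1 + 1 * p.2)) ∂bathPairLaw := by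
  rw [lambdaPlusInf, ← integral_densityQ_mul (k := fun x => flipWeight δ (α * x)) (by fun_prop)
    fun _ => abs_flipWeight_le_one _ _]
  simp only [flipWeight, mul_pow]

lemma lambdaMinusInf_eq (α δ : ℝ) :
    lambdaMinusInf α δ = 1 / 2 * ∫ p : ℝ × ℝ, flipWeight δ (α * (p.1 + -1 * p.2)) ∂bathPairLaw := by
  rw [lambdaMinusInf, ← integral_densityR_mul (k := fun x => flipWeight δ (α * x)) (by fun_prop)
    fun _ => abs_flipWeight_le_one _ _]
  simp only [flipWeight, mul_pow]

/-- Riemann–Lebesgue for the sum or the difference of the bath variables: it is enough to integrate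
over one of them. -/
lemma tendsto_integral_cos_freq_pair {α : ℝ} (hα : α ≠ 0) (δ : ℝ) {ε : ℝ} (hε : ε = 1 ∨ ε = -1)
    {h : ℝ → ℝ} (hh : Measurable h) (hC : ∀ x, |h x| ≤ 1) :
    Tendsto (fun t : ℝ => ∫ p : ℝ × ℝ, Real.cos (t * freq δ (α * (p.1 + ε * p.2))) *
      h (p.1 + ε * p.2) ∂bathPairLaw) atTop (𝓝 0) := by
  have hbound : ∀ t x, |Real.cos (t * freq δ (α * x)) * h x| ≤ 1 := fun t x => by
    rw [abs_mul]
    exact mul_le_one₀ (Real.abs_cos_le_one _) (abs_nonneg _) (hC x)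
  have hfreq := continuous_freq δ
  have hint : ∀ t, Integrable (fun p : ℝ × ℝ => Real.cos (t * freq δ (α * (p.1 + ε * p.2))) *
      h (p.1 + ε * p.2)) bathPairLaw := fun t =>
    integrable_bathPairLaw_of_bounded
      ((Continuous.measurable (by fun_prop)).mul (hh.comp (by fun_prop))) fun p => hbound t _
  have heq : ∀ t, ∫ p : ℝ × ℝ, Real.cos (t * freq δ (α * (p.1 + ε * p.2))) *
      h (p.1 + ε * p.2) ∂bathPairLaw = ∫ r, ∫ s, Real.cos (t * freq δ (α * (r + ε * s))) *
      h (r + ε * s) ∂bathLaw ∂bathLaw := fun t => integral_prod _ (hint t)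
  simp only [heq]
  rw [show (0 : ℝ) = ∫ _ : ℝ, (0 : ℝ) ∂bathLaw by simp]
  refine tendsto_integral_filter_of_dominated_convergence (fun _ => 1)
    (Eventually.of_forall fun t => (hint t).integral_prod_left.aestronglyMeasurable)
    (Eventually.of_forall fun t => Eventually.of_forall fun r => ?_) (integrable_const _)
    (Eventually.of_forall fun r => ?_)
  · have := norm_integral_le_of_norm_le_const (μ := bathLaw) (C := 1)
      (f := fun s => Real.cos (t * freq δ (α * (r + ε * s))) * h (r + ε * s))
      (Eventually.of_forall fun s => hbound t _)
    simpa using this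
  · have hg : Integrable fun s => extDensity s * h (r + ε * s) :=
      integrable_extDensity.mul_bdd (c := 1) (hh.comp (by fun_prop)).aestronglyMeasurable
        (Eventually.of_forall fun s => hC _)
    have hεα : ε * α ≠ 0 := mul_ne_zero (by rcases hε with rfl | rfl <;> norm_num) hα
    refine (tendsto_integral_cos_freq hεα δ (ε * r) hg).1.congr fun t => ?_
    rw [integral_bathLaw_eq_extDensity]
    congr 1
    ext s
    have : ε * α * (s + ε * r) = α * (r + ε * s) := by rcases hε with rfl | rfl <;> ring
    rw [this]
    ring

lemma tendsto_lambdaIntegral {α : ℝ} (hα : α ≠ 0) (δ : ℝ) {ε : ℝ} (hε : ε = 1 ∨ ε = -1) :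
    Tendsto (fun t : ℝ => lambdaIntegral ε α δ t) atTop
      (𝓝 (1 / 2 * ∫ p : ℝ × ℝ, flipWeight δ (α * (p.1 + ε * p.2)) ∂bathPairLaw)) := by
  have h := (tendsto_integral_cos_freq_pair hα δ hε (h := fun x => flipWeight δ (α * x))
    (by fun_prop) fun x => abs_flipWeight_le_one _ _).comp (tendsto_id.const_mul_atTop two_pos)
  have h2 := (h.const_mul (-(1 / 2))).const_add
    (1 / 2 * ∫ p : ℝ × ℝ, flipWeight δ (α * (p.1 + ε * p.2)) ∂bathPairLaw)
  rw [mul_zero, add_zero] at h2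
  refine h2.congr fun t => ?_
  rw [lambdaIntegral_eq]
  simp only [Function.comp, id]
  rw [← integral_const_mul, ← integral_const_mul, ← integral_add]
  · congr 1
    ext p
    rw [flipAmp_sq, Real.sin_sq_eq_half_sub, mul_assoc 2 t]
    ring
  · exact (integrable_flipWeight ε α δ).const_mul _
  · refine Integrable.const_mul ?_ _
    refine (integrable_flipWeight ε α δ).bdd_mul (c := 1) ?_
      (Eventually.of_forall fun p => Real.abs_cos_le_one _)
    have := continuous_freq δ
    exact Continuous.aestronglyMeasurable (by fun_prop)

/-- The sum and the difference of the bath variables oscillate independently: for a given sum the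
difference still has a density, so the Riemann–Lebesgue lemma applies to it. -/
lemma tendsto_integral_cross {α : ℝ} (hα : α ≠ 0) (δ : ℝ) {K : ℝ → ℝ → ℝ}
    (hK : ∀ t, Measurable (K t)) (hK1 : ∀ t x, |K t x| ≤ 1) {h : ℝ → ℝ} (hh : Measurable h)
    (hC : ∀ x, |h x| ≤ 1) {trig : ℝ → ℝ} (htrig : Continuous trig) (htrig1 : ∀ x, |trig x| ≤ 1)
    (hRL : ∀ (a c : ℝ) (g : ℝ → ℝ), a ≠ 0 → Integrable g →
      Tendsto (fun t : ℝ => ∫ y, trig (t * freq δ (a * (y + c))) * g y) atTop (𝓝 0)) :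
    Tendsto (fun t : ℝ => ∫ p : ℝ × ℝ, K t (p.1 + 1 * p.2) *
      (trig (t * freq δ (α * (p.1 + -1 * p.2))) * h (p.1 + -1 * p.2)) ∂bathPairLaw)
      atTop (𝓝 0) := by
  have hfreq := continuous_freq δ
  let k : ℝ → ℝ × ℝ → ℝ := fun t q =>
    K t q.1 * (trig (t * freq δ (α * (2 * q.2 - q.1))) * h (2 * q.2 - q.1))
  have hk : ∀ t, Measurable (k t) := fun t => ((hK t).comp measurable_fst).mul
    ((Continuous.measurable (by fun_prop)).mul (hh.comp (by fun_prop)))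
  have hk1 : ∀ t q, |k t q| ≤ 1 := fun t q => by
    simp only [k, abs_mul]
    exact mul_le_one₀ (hK1 _ _) (by positivity)
      (mul_le_one₀ (htrig1 _) (abs_nonneg _) (hC _))
  have hkp : ∀ t (p : ℝ × ℝ), K t (p.1 + 1 * p.2) *
      (trig (t * freq δ (α * (p.1 + -1 * p.2))) * h (p.1 + -1 * p.2)) =
      k t (p.1 + p.2, p.1) := by
    intro t p
    simp only [k]
    rw [one_mul, show p.1 + -1 * p.2 = 2 * p.1 - (p.1 + p.2) by ring]
  have heq : ∀ t, ∫ p : ℝ × ℝ, K t (p.1 + 1 * p.2) *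
      (trig (t * freq δ (α * (p.1 + -1 * p.2))) * h (p.1 + -1 * p.2)) ∂bathPairLaw =
      ∫ μ, ∫ r, extDensity r * extDensity (μ - r) * k t (μ, r) := by
    intro t
    simp only [hkp]
    have hm : Measurable fun p : ℝ × ℝ => k t (p.1 + p.2, p.1) :=
      (hk t).comp (by fun_prop : Measurable fun p : ℝ × ℝ => (p.1 + p.2, p.1))
    rw [integral_bathPairLaw (integrable_bathPairLaw_of_bounded (C := 1) hm fun p => hk1 t _)]
    exact integral_shear integrable_extDensity integrable_extDensity (hk t) (hk1 t)
  simp only [heq]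
  have hconv := integrable_shear integrable_extDensity integrable_extDensity (k := fun _ => 1)
    measurable_const (C := 1) (by simp)
  simp only [mul_one] at hconv
  have hnn : ∀ μ r, 0 ≤ extDensity r * extDensity (μ - r) := fun μ r =>
    mul_nonneg (extDensity_nonneg _) (extDensity_nonneg _)
  rw [show (0 : ℝ) = ∫ _ : ℝ, (0 : ℝ) by simp]
  refine tendsto_integral_filter_of_dominated_convergence
    (fun μ => ∫ r, extDensity r * extDensity (μ - r))
    (Eventually.of_forall fun t => (integrable_shear integrable_extDensity integrable_extDensity
      (hk t) (hk1 t)).integral_prod_left.aestronglyMeasurable)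
    (Eventually.of_forall fun t => ?_) hconv.integral_prod_left ?_
  · filter_upwards [hconv.prod_right_ae] with μ hμ
    refine norm_integral_le_of_norm_le hμ (Eventually.of_forall fun r => ?_)
    rw [norm_mul, Real.norm_of_nonneg (hnn μ r)]
    exact mul_le_of_le_one_right (hnn μ r) (hk1 t _)
  · filter_upwards [hconv.prod_right_ae] with μ hμ
    have hg : Integrable fun r => extDensity r * extDensity (μ - r) * h (2 * r - μ) :=
      hμ.mul_bdd (c := 1) (hh.comp (by fun_prop)).aestronglyMeasurable
        (Eventually.of_forall fun r => hC _)
    have h1 := hRL (2 * α) (-μ / 2) _ (mul_ne_zero two_ne_zero hα) hg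
    refine squeeze_zero_norm (fun t => ?_) (tendsto_zero_iff_norm_tendsto_zero.1 h1)
    have h2 : ∫ r, extDensity r * extDensity (μ - r) * k t (μ, r) =
        K t μ * ∫ r, trig (t * freq δ (2 * α * (r + -μ / 2))) *
          (extDensity r * extDensity (μ - r) * h (2 * r - μ)) := by
      rw [← integral_const_mul]
      congr 1
      ext r
      simp only [k]
      rw [show 2 * α * (r + -μ / 2) = α * (2 * r - μ) by ring]
      ring
    rw [h2, norm_mul]
    exact mul_le_of_le_one_left (norm_nonneg _) (hK1 t μ)

lemma mul_sinOver_eq (δ t x : ℝ) :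
    δ * sinOver t (freq δ x) = Real.sin (t * freq δ x) * (δ / freq δ x) := by
  rw [← mul_sinOver]
  rcases eq_or_ne (freq δ x) 0 with h | h
  · have h1 := freq_sq δ x
    rw [h] at h1
    have : δ = 0 := by nlinarith [sq_nonneg δ, sq_nonneg x]
    simp [this]
  · field_simp

lemma abs_div_freq_le_one (δ x : ℝ) : |δ / freq δ x| ≤ 1 := by
  have h0 : 0 ≤ freq δ x := Real.sqrt_nonneg _
  rw [abs_div, abs_of_nonneg h0]
  exact div_le_one_of_le₀ (Real.abs_le_sqrt (by nlinarith [sq_nonneg x])) (Real.sqrt_nonneg _)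

/-- Average over the bath of the interference term of the two parity sectors. -/
noncomputable def crossTerm (α δ t : ℝ) : ℝ :=
  ∫ p : ℝ × ℝ, (stayAmp δ t (α * (p.1 + 1 * p.2)) *
    starRingEnd ℂ (stayAmp δ t (α * (p.1 + -1 * p.2)))).re ∂bathPairLaw

lemma re_stayAmp_mul_conj (δ t x y : ℝ) :
    (stayAmp δ t x * starRingEnd ℂ (stayAmp δ t y)).re =
      Real.cos (t * freq δ x) * (Real.cos (t * freq δ y) * 1) +
        Real.sin (t * freq δ x) * (δ / freq δ x) *
          (Real.sin (t * freq δ y) * (δ / freq δ y)) := by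
  rw [← mul_sinOver_eq, ← mul_sinOver_eq]
  simp [stayAmp, -Complex.ofReal_cos]

lemma tendsto_crossTerm {α : ℝ} (hα : α ≠ 0) (δ : ℝ) :
    Tendsto (fun t => crossTerm α δ t) atTop (𝓝 0) := by
  have hfreq := continuous_freq δ
  have hm := hfreq.measurable
  have h1 := tendsto_integral_cross hα δ (K := fun t x => Real.cos (t * freq δ (α * x)))
    (fun t => Continuous.measurable (by fun_prop)) (fun t x => Real.abs_cos_le_one _)
    (h := fun _ => 1) measurable_const (by simp) Real.continuous_cos Real.abs_cos_le_one
    fun a c g ha hg => (tendsto_integral_cos_freq ha δ c hg).1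
  have hb : ∀ t x, |Real.sin (t * freq δ x) * (δ / freq δ x)| ≤ 1 := fun t x => by
    rw [abs_mul]
    exact mul_le_one₀ (Real.abs_sin_le_one _) (abs_nonneg _) (abs_div_freq_le_one _ _)
  have h2 := tendsto_integral_cross hα δ
    (K := fun t x => Real.sin (t * freq δ (α * x)) * (δ / freq δ (α * x)))
    (fun t => by fun_prop) (fun t x => hb t _)
    (h := fun x => δ / freq δ (α * x)) (by fun_prop) (fun x => abs_div_freq_le_one _ _)
    Real.continuous_sin Real.abs_sin_le_one
    fun a c g ha hg => (tendsto_integral_cos_freq ha δ c hg).2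
  have h3 := h1.add h2
  rw [add_zero] at h3
  refine h3.congr fun t => ?_
  rw [crossTerm, ← integral_add]
  · simp only [re_stayAmp_mul_conj]
  · refine integrable_bathPairLaw_of_bounded (C := 1) (by fun_prop) fun p => ?_
    rw [mul_one, abs_mul]
    exact mul_le_one₀ (Real.abs_cos_le_one _) (abs_nonneg _) (Real.abs_cos_le_one _)
  · refine integrable_bathPairLaw_of_bounded (C := 1) (by fun_prop) fun p => ?_
    rw [abs_mul]
    exact mul_le_one₀ (hb _ _) (abs_nonneg _) (hb _ _)

lemma limitWeight_eq (α δ t : ℝ) :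
    limitWeight α δ t = (lambdaPlus α δ t + lambdaMinus α δ t) / 4 := by
  rw [limitWeight, lambdaPlus, lambdaMinus, lambdaIntegral_eq, lambdaIntegral_eq, ← integral_add
    (integrable_flipAmp_sq _ _ _ _) (integrable_flipAmp_sq _ _ _ _), integral_div]

lemma tendsto_lambdaPlus {α : ℝ} (hα : α ≠ 0) (δ : ℝ) :
    Tendsto (fun t : ℝ => lambdaPlus α δ t) atTop (𝓝 (lambdaPlusInf α δ)) := by
  rw [lambdaPlusInf_eq]
  exact tendsto_lambdaIntegral hα δ (Or.inl rfl)

lemma tendsto_lambdaMinus {α : ℝ} (hα : α ≠ 0) (δ : ℝ) :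
    Tendsto (fun t : ℝ => lambdaMinus α δ t) atTop (𝓝 (lambdaMinusInf α δ)) := by
  rw [lambdaMinusInf_eq]
  exact tendsto_lambdaIntegral hα δ (Or.inr rfl)

lemma tendsto_limitWeight {α : ℝ} (hα : α ≠ 0) (δ : ℝ) :
    Tendsto (fun t : ℝ => limitWeight α δ t) atTop (𝓝 (bigPi α δ / 4)) := by
  simp only [limitWeight_eq]
  exact ((tendsto_lambdaPlus hα δ).add (tendsto_lambdaMinus hα δ)).div_const 4

lemma integrable_re_stayAmp_mul_conj (α δ t : ℝ) :
    Integrable (fun p : ℝ × ℝ => (stayAmp δ t (α * (p.1 + 1 * p.2)) *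
      starRingEnd ℂ (stayAmp δ t (α * (p.1 + -1 * p.2)))).re) bathPairLaw := by
  refine integrable_bathPairLaw_of_bounded (C := 1) ?_ fun p => ?_
  · have := continuous_stayAmp δ t
    exact Continuous.measurable (by fun_prop)
  · refine (Complex.abs_re_le_norm _).trans ?_
    rw [norm_mul, Complex.norm_conj]
    exact mul_le_one₀ (norm_stayAmp_le_one _ _ _) (norm_nonneg _) (norm_stayAmp_le_one _ _ _)

lemma integrable_mean_flipAmp_sq (α δ t : ℝ) :
    Integrable (fun p : ℝ × ℝ => (flipAmp δ t (α * (p.1 + 1 * p.2)) ^ 2 +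
      flipAmp δ t (α * (p.1 + -1 * p.2)) ^ 2) / 4) bathPairLaw :=
  ((integrable_flipAmp_sq 1 α δ t).add (integrable_flipAmp_sq (-1) α δ t)).div_const 4

/-- The coherence is half the weight of `−+`, corrected by the interference of the sectors. -/
lemma limitCoherence_eq (α δ t : ℝ) :
    limitCoherence α δ t = (1 - 2 * limitWeight α δ t) / 4 + crossTerm α δ t / 4 := by
  have h3 := integrable_mean_flipAmp_sq α δ t
  have h4 := integrable_re_stayAmp_mul_conj α δ t
  have h5 : ∀ p : ℝ × ℝ, Complex.normSq (stayAmp δ t (α * (p.1 + 1 * p.2)) +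
      stayAmp δ t (α * (p.1 + -1 * p.2))) / 8 = (1 / 4 - 1 / 2 *
        ((flipAmp δ t (α * (p.1 + 1 * p.2)) ^ 2 + flipAmp δ t (α * (p.1 + -1 * p.2)) ^ 2) / 4)) +
      1 / 4 * (stayAmp δ t (α * (p.1 + 1 * p.2)) *
        starRingEnd ℂ (stayAmp δ t (α * (p.1 + -1 * p.2)))).re := by
    intro p
    rw [Complex.normSq_add, normSq_stayAmp, normSq_stayAmp]
    ring
  rw [limitCoherence, limitWeight, crossTerm]
  simp only [h5]
  have h6 : Integrable (fun p : ℝ × ℝ => 1 / 4 - 1 / 2 * ((flipAmp δ t (α * (p.1 + 1 * p.2)) ^ 2 +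
      flipAmp δ t (α * (p.1 + -1 * p.2)) ^ 2) / 4)) bathPairLaw :=
    (integrable_const _).sub (h3.const_mul _)
  rw [integral_add h6 (h4.const_mul _), integral_sub (integrable_const _) (h3.const_mul _),
    integral_const_mul, integral_const_mul]
  simp
  ring

lemma tendsto_limitCoherence {α : ℝ} (hα : α ≠ 0) (δ : ℝ) :
    Tendsto (fun t : ℝ => limitCoherence α δ t) atTop (𝓝 ((2 - bigPi α δ) / 8)) := by
  simp only [limitCoherence_eq]
  have h := ((((tendsto_limitWeight hα δ).const_mul 2).const_sub 1).div_const 4).add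
    ((tendsto_crossTerm hα δ).div_const 4)
  convert h using 2
  ring

lemma limitWeight_nonneg (α δ t : ℝ) : 0 ≤ limitWeight α δ t :=
  integral_nonneg fun p => by positivity

lemma limitCoherence_nonneg (α δ t : ℝ) : 0 ≤ limitCoherence α δ t :=
  integral_nonneg fun p => div_nonneg (Complex.normSq_nonneg _) (by norm_num)

/-- The limiting state is positive semidefinite on the span of `−+` and `+−`. -/
lemma limitCoherence_le (α δ t : ℝ) : limitCoherence α δ t ≤ 1 / 2 - limitWeight α δ t := by
  have h : crossTerm α δ t ≤ 1 - 2 * limitWeight α δ t := by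
    have h3 := integrable_mean_flipAmp_sq α δ t
    have h1 : 1 - 2 * limitWeight α δ t = ∫ p : ℝ × ℝ, (1 - 2 *
        ((flipAmp δ t (α * (p.1 + 1 * p.2)) ^ 2 + flipAmp δ t (α * (p.1 + -1 * p.2)) ^ 2) / 4))
          ∂bathPairLaw := by
      rw [integral_sub (integrable_const _) (h3.const_mul _), integral_const_mul, limitWeight]
      simp
    rw [h1, crossTerm]
    refine integral_mono (integrable_re_stayAmp_mul_conj α δ t)
      ((integrable_const _).sub (h3.const_mul _)) fun p => ?_
    have h2 := Complex.normSq_nonneg (stayAmp δ t (α * (p.1 + 1 * p.2)) -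
      stayAmp δ t (α * (p.1 + -1 * p.2)))
    rw [Complex.normSq_sub, normSq_stayAmp, normSq_stayAmp] at h2
    simp only
    linarith
  rw [limitCoherence_eq]
  linarith

/-! ### Bounds and limits of the asymptotic weight -/

lemma integral_flipWeight_mem_Icc (ε α δ : ℝ) :
    ∫ p : ℝ × ℝ, flipWeight δ (α * (p.1 + ε * p.2)) ∂bathPairLaw ∈ Icc (0 : ℝ) 1 := by
  refine ⟨integral_nonneg fun p => flipWeight_nonneg _ _, ?_⟩
  have := integral_mono (integrable_flipWeight ε α δ) (integrable_const (1 : ℝ))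
    fun p => flipWeight_le_one _ _
  simpa using this

lemma bigPi_mem_Icc (α δ : ℝ) : bigPi α δ ∈ Icc (0 : ℝ) 1 := by
  have h1 := integral_flipWeight_mem_Icc 1 α δ
  have h2 := integral_flipWeight_mem_Icc (-1) α δ
  rw [bigPi, lambdaPlusInf_eq, lambdaMinusInf_eq]
  exact ⟨by linarith [h1.1, h2.1], by linarith [h1.2, h2.2]⟩

/-- The sum and the difference of the bath variables are almost surely nonzero. -/
lemma ae_add_mul_ne_zero {ε : ℝ} (hε : ε = 1 ∨ ε = -1) :
    ∀ᵐ p : ℝ × ℝ ∂bathPairLaw, p.1 + ε * p.2 ≠ 0 := by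
  have hac : bathLaw ≪ volume :=
    (withDensity_absolutelyContinuous _ _).trans Measure.absolutelyContinuous_restrict
  have hmeas : MeasurableSet {p : ℝ × ℝ | p.1 + ε * p.2 ≠ 0} :=
    (measurableSet_eq_fun (by fun_prop) (by fun_prop)).compl
  rw [bathPairLaw, Measure.ae_prod_iff_ae_ae hmeas]
  refine Eventually.of_forall fun r => hac.ae_le ?_
  have h : ∀ᵐ s : ℝ, s ≠ -(ε * r) := by
    simp [ae_iff]
  filter_upwards [h] with s hs h0
  apply hs
  rcases hε with rfl | rfl <;> linarith

lemma tendsto_integral_flipWeight {l : Filter ℝ} [l.IsCountablyGenerated] {c : ℝ} (α : ℝ) {ε : ℝ}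
    (hε : ε = 1 ∨ ε = -1)
    (h : ∀ x : ℝ, x ≠ 0 → Tendsto (fun δ => flipWeight δ (α * x)) l (𝓝 c)) :
    Tendsto (fun δ => ∫ p : ℝ × ℝ, flipWeight δ (α * (p.1 + ε * p.2)) ∂bathPairLaw) l (𝓝 c) := by
  rw [show c = ∫ _ : ℝ × ℝ, c ∂bathPairLaw by simp]
  refine tendsto_integral_filter_of_dominated_convergence (fun _ => 1)
    (Eventually.of_forall fun δ => (integrable_flipWeight ε α δ).aestronglyMeasurable)
    (Eventually.of_forall fun δ => Eventually.of_forall fun p => abs_flipWeight_le_one _ _)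
    (integrable_const _) ?_
  filter_upwards [ae_add_mul_ne_zero hε] with p hp using h _ hp

lemma tendsto_bigPi {l : Filter ℝ} [l.IsCountablyGenerated] {c : ℝ} (α : ℝ)
    (h : ∀ x : ℝ, x ≠ 0 → Tendsto (fun δ => flipWeight δ (α * x)) l (𝓝 c)) :
    Tendsto (fun δ => bigPi α δ) l (𝓝 c) := by
  have h1 := (tendsto_integral_flipWeight α (Or.inl rfl) h).const_mul (1 / 2)
  have h2 := (tendsto_integral_flipWeight α (Or.inr rfl) h).const_mul (1 / 2)
  simp only [bigPi, lambdaPlusInf_eq, lambdaMinusInf_eq]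
  convert h1.add h2 using 2
  ring

lemma tendsto_bigPi_zero {α : ℝ} (hα : α ≠ 0) : Tendsto (fun δ => bigPi α δ) (𝓝 0) (𝓝 1) := by
  refine tendsto_bigPi α fun x hx => ?_
  have hx2 : (α * x) ^ 2 ≠ 0 := pow_ne_zero 2 (mul_ne_zero hα hx)
  have hc : ContinuousAt (fun δ => flipWeight δ (α * x)) 0 := by
    unfold flipWeight
    refine ContinuousAt.div (by fun_prop) (by fun_prop) ?_
    simpa using hx2
  have := hc.tendsto
  simpa [flipWeight, div_self hx2] using this

lemma tendsto_bigPi_atTop (α : ℝ) : Tendsto (fun δ => bigPi α δ) atTop (𝓝 0) := by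
  refine tendsto_bigPi α fun x _ => ?_
  unfold flipWeight
  exact Tendsto.const_div_atTop
    (tendsto_atTop_add_const_right _ _ (tendsto_pow_atTop two_ne_zero)) _

/-! ### Concurrence of X-states -/

/-- An X-state with real entries commutes with the spin flip `σ_y ⊗ σ_y`. -/
lemma spinFlipProduct_xState (a b c : ℝ) :
    spinFlipProduct (xState a b c) = (!![(a ^ 2 : ℂ), 0, 0, 0;
      0, b ^ 2 + c ^ 2, -(2 * b * c), 0;
      0, -(2 * b * c), b ^ 2 + c ^ 2, 0;
      0, 0, 0, (a ^ 2 : ℂ)]).submatrix finProdFinEquiv finProdFinEquiv := by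
  ext ⟨i, j⟩ ⟨k, l⟩
  fin_cases i <;> fin_cases j <;> fin_cases k <;> fin_cases l <;>
    simp [spinFlipProduct, xState, Matrix.mul_apply, Fintype.sum_prod_type, pauliY, spinPlus,
      spinMinus, finProdFinEquiv] <;> ring

open Polynomial in
lemma charpoly_spinFlipProduct_xState (a b c : ℝ) :
    (spinFlipProduct (xState a b c)).charpoly = (X - C ((a ^ 2 : ℝ) : ℂ)) *
      ((X - C ((a ^ 2 : ℝ) : ℂ)) * ((X - C (((b - c) ^ 2 : ℝ) : ℂ)) *
        (X - C (((b + c) ^ 2 : ℝ) : ℂ)))) := by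
  rw [spinFlipProduct_xState, ← Equiv.symm_symm (finProdFinEquiv (m := 2) (n := 2)),
    ← Matrix.reindex_apply, Matrix.charpoly_reindex, Matrix.charpoly]
  simp [Matrix.det_succ_row_zero, Fin.sum_univ_succ, Matrix.charmatrix_apply, Matrix.diagonal,
    -mul_eq_mul_left_iff]
  rw [show (C 2 : ℂ[X]) = 2 from map_ofNat C 2]
  ring

lemma sqrtEigenvalues_xState {a b c : ℝ} (ha : 0 ≤ a) (hc : 0 ≤ c) (hcb : c ≤ b) :
    sqrtEigenvalues (xState a b c) = {a, a, b - c, b + c} := by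
  open Polynomial in
  have h : (X - C ((a ^ 2 : ℝ) : ℂ)) * ((X - C ((a ^ 2 : ℝ) : ℂ)) *
      ((X - C (((b - c) ^ 2 : ℝ) : ℂ)) * (X - C (((b + c) ^ 2 : ℝ) : ℂ)))) =
      (({((a ^ 2 : ℝ) : ℂ), ((a ^ 2 : ℝ) : ℂ), (((b - c) ^ 2 : ℝ) : ℂ),
        (((b + c) ^ 2 : ℝ) : ℂ)} : Multiset ℂ).map fun z => X - C z).prod := by
    simp
  rw [sqrtEigenvalues, charpoly_spinFlipProduct_xState, h, Polynomial.roots_multiset_prod_X_sub_C]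
  simp only [Multiset.insert_eq_cons, Multiset.map_cons, Multiset.map_singleton, Complex.ofReal_re,
    Real.sqrt_sq ha, Real.sqrt_sq (sub_nonneg.2 hcb), Real.sqrt_sq (add_nonneg (hc.trans hcb) hc)]

lemma concurrence_xState {a b c : ℝ} (ha : 0 ≤ a) (hc : 0 ≤ c) (hcb : c ≤ b) :
    concurrence (xState a b c) = max 0 (2 * (c - a)) := by
  have hm : max (b + c) 0 = b + c := max_eq_left (by linarith)
  have hm' : max (b - c) (b + c) = b + c := max_eq_right (by linarith)
  have hm'' : max a (max a (b + c)) = max a (b + c) := by rw [← max_assoc, max_self]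
  rw [concurrence, sqrtEigenvalues_xState ha hc hcb]
  simp only [Multiset.insert_eq_cons, Multiset.fold_cons_left, Multiset.fold_singleton,
    Multiset.sum_cons, Multiset.sum_singleton, hm, hm', hm'']
  rcases le_total a (b + c) with h | h
  · rw [max_eq_right h]
    congr 1
    ring
  · rw [max_eq_left h, max_eq_left, max_eq_left] <;> linarith

/-! ### The asymptotic state and its concurrence -/

lemma tendsto_xState {ι : Type*} {l : Filter ι} {a b c : ι → ℝ} {a₀ b₀ c₀ : ℝ}
    (ha : Tendsto a l (𝓝 a₀)) (hb : Tendsto b l (𝓝 b₀)) (hc : Tendsto c l (𝓝 c₀)) :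
    Tendsto (fun i => xState (a i) (b i) (c i)) l (𝓝 (xState a₀ b₀ c₀)) := by
  refine tendsto_pi_nhds.2 fun p => tendsto_pi_nhds.2 fun q => ?_
  simp only [xState, Matrix.of_apply]
  split_ifs
  · exact (Complex.continuous_ofReal.tendsto _).comp ha
  · exact (Complex.continuous_ofReal.tendsto _).comp hb
  · exact ((Complex.continuous_ofReal.tendsto _).comp hc).neg
  · exact tendsto_const_nhds

lemma concurrence_asymptoticState {P : ℝ} (hP : P ∈ Icc (0 : ℝ) 1) :
    concurrence (asymptoticState P) = max 0 ((2 - 3 * P) / 4) := by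
  obtain ⟨h0, h1⟩ := hP
  rw [asymptoticState_eq, concurrence_xState (by linarith) (by linarith) (by linarith)]
  congr 1
  ring

end SpinStar

theorem mainTheorem3 (α : ℝ) (hα : α ≠ 0) :
    (∀ δ : ℝ,
      Tendsto (fun t : ℝ => SpinStar.lambdaPlus α δ t) atTop (𝓝 (SpinStar.lambdaPlusInf α δ)) ∧
      Tendsto (fun t : ℝ => SpinStar.lambdaMinus α δ t) atTop (𝓝 (SpinStar.lambdaMinusInf α δ)) ∧
      SpinStar.bigPi α δ ∈ Icc (0 : ℝ) 1 ∧
      (∃ ρ : ℝ → Matrix SpinStar.Qubits SpinStar.Qubits ℂ,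
        (∀ t : ℝ, Tendsto
          (fun N : ℕ => SpinStar.reducedState N α δ SpinStar.singletState t) atTop (𝓝 (ρ t))) ∧
        Tendsto ρ atTop (𝓝 (SpinStar.asymptoticState (SpinStar.bigPi α δ))) ∧
        Tendsto (fun t : ℝ => SpinStar.concurrence (ρ t)) atTop
          (𝓝 (max 0 ((2 - 3 * SpinStar.bigPi α δ) / 4)))) ∧
      SpinStar.concurrence (SpinStar.asymptoticState (SpinStar.bigPi α δ)) =
        max 0 ((2 - 3 * SpinStar.bigPi α δ) / 4)) ∧
    (∀ᶠ δ in 𝓝 (0 : ℝ),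
      SpinStar.concurrence (SpinStar.asymptoticState (SpinStar.bigPi α δ)) = 0) ∧
    Tendsto (fun δ : ℝ => SpinStar.concurrence (SpinStar.asymptoticState (SpinStar.bigPi α δ)))
      (𝓝 0) (𝓝 0) ∧
    Tendsto (fun δ : ℝ => SpinStar.concurrence (SpinStar.asymptoticState (SpinStar.bigPi α δ)))
      atTop (𝓝 (1 / 2)) := by
  have hC : ∀ δ : ℝ, SpinStar.concurrence (SpinStar.asymptoticState (SpinStar.bigPi α δ)) =
      max 0 ((2 - 3 * SpinStar.bigPi α δ) / 4) := fun δ =>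
    SpinStar.concurrence_asymptoticState (SpinStar.bigPi_mem_Icc α δ)
  have hev : ∀ᶠ δ in 𝓝 (0 : ℝ),
      SpinStar.concurrence (SpinStar.asymptoticState (SpinStar.bigPi α δ)) = 0 := by
    filter_upwards [(SpinStar.tendsto_bigPi_zero hα).eventually_const_lt
      (by norm_num : (2 / 3 : ℝ) < 1)] with δ hδ
    rw [hC]
    exact max_eq_left (by linarith)
  refine ⟨fun δ => ⟨SpinStar.tendsto_lambdaPlus hα δ, SpinStar.tendsto_lambdaMinus hα δ,
    SpinStar.bigPi_mem_Icc α δ, ⟨fun t => SpinStar.xState (SpinStar.limitWeight α δ t)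
      (1 / 2 - SpinStar.limitWeight α δ t) (SpinStar.limitCoherence α δ t), fun t =>
      SpinStar.tendsto_reducedState_singlet α δ t, ?_, ?_⟩, hC δ⟩, hev, ?_, ?_⟩
  · rw [SpinStar.asymptoticState_eq, show (2 - SpinStar.bigPi α δ) / 4 =
      1 / 2 - SpinStar.bigPi α δ / 4 by ring]
    exact SpinStar.tendsto_xState (SpinStar.tendsto_limitWeight hα δ)
      ((SpinStar.tendsto_limitWeight hα δ).const_sub _) (SpinStar.tendsto_limitCoherence hα δ)
  · simp only [SpinStar.concurrence_xState (SpinStar.limitWeight_nonneg α δ _)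
      (SpinStar.limitCoherence_nonneg α δ _) (SpinStar.limitCoherence_le α δ _)]
    have h := tendsto_const_nhds (x := (0 : ℝ)).max (((SpinStar.tendsto_limitCoherence hα δ).sub
      (SpinStar.tendsto_limitWeight hα δ)).const_mul 2)
    rwa [show 2 * ((2 - SpinStar.bigPi α δ) / 8 - SpinStar.bigPi α δ / 4) =
      (2 - 3 * SpinStar.bigPi α δ) / 4 by ring] at h
  · exact tendsto_const_nhds.congr' (hev.mono fun δ hδ => hδ.symm)
  · simp only [hC]
    have h := tendsto_const_nhds (x := (0 : ℝ)).max
      ((((SpinStar.tendsto_bigPi_atTop α).const_mul 3).const_sub 2).div_const 4)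
    convert h using 2
    norm_num
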